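/- **Definitions.** An *SMC-category* is a bicategory $\mathbf B$ together with a symmetric monoidal structure $(\oplus,\mathbf 0)$ on every category $\mathbf B(a,b)$, such that composition is bilinear in the following sense. The two adjoints of each composition functor $\circ:\mathbf B(b,c)\times\mathbf B(a,b)\to\mathbf B(a,c)$, namely $g\mapsto g\circ-$ from $\mathbf B(b,c)$ to $\mathbf{CAT}(\mathbf B(a,b),\mathbf B(a,c))$ and $f\mapsto -\circ f$ from $\mathbf B(a,b)$ to $\mathbf{CAT}(\mathbf B(b,c),\mathbf B(a,c))$, are equipped with symmetric strong monoidal structures, where the functor categories carry the pointwise monoidal structure of $\mathbf B(a,c)$. In particular every functor $g\circ-$ and $-\circ f$ is symmetric strong monoidal. It is required that 1. the isomorphisms $(g\oplus g')\circ-\cong(g\circ-)\oplus(g'\circ-)$, $-\circ(f\oplus f')\cong(-\circ f)\oplus(-\circ f')$, $\mathbf 0\circ-\cong\mathbf 0$ and $-\circ\mathbf 0\cong\mathbf 0$ are isomorphisms of monoidal functors; 2. the isomorphisms $h\circ(g\circ-)\cong(h\circ g)\circ-$, $(-\circ g)\circ f\cong-\circ(g\circ f)$, $h\circ(-\circ f)\cong(h\circ-)\circ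 f$, $-\circ\mathbf 1\cong\mathrm{id}$ and $\mathbf 1\circ-\cong\mathrm{id}$ given by the bicategory structure are isomorphisms of monoidal functors. An *SMC-functor* $F:\mathbf B\to\mathbf C$ is a pseudofunctor with a symmetric strong monoidal structure on each $F:\mathbf B(a,b)\to\mathbf C(Fa,Fb)$, such that the constraint $F(g\circ f)\cong Fg\circ Ff$ is a monoidal transformation in $f$ for each fixed $g$ and in $g$ for each fixed $f$. A *strong monoidal transformation* $\eta:F\Rightarrow G$ of SMC-functors is a strong (pseudonatural) transformation such that, for all $a,b$, the constraint $\eta_b\circ Ff\cong Gf\circ\eta_a$ is a monoidal transformation in $f\in\mathbf B(a,b)$. SMC-functors $\mathbf B\to\mathbf C$, strong monoidal transformations and all modifications between them form a bicategory $\mathbf{SMC\text{-}Cat}(\mathbf B,\mathbf C)$. An SMC-functor $F:\mathbf B\to\mathbf C$ is a *biequivalence of SMC-categories* if there are an SMC-functor $G:\mathbf C\to\mathbf B$, an equivalence $FG\simeq 1_{\mathbf C}$ in $\mathbf{SMC\text{-}Cat}(\mathbf C,\mathbf C)$ and an equivalence $1_{\mathbf B}\simeq GF$ in $\mathbf{SMC\text{-}Cat}(\mathbf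 B,\mathbf B)$. Fix universe levels for the sets of objects and the sets of morphisms of categories. $\mathbf{SymMon}$ is the $2$-category of symmetric monoidal categories, symmetric strong monoidal functors and monoidal transformations. It is an SMC-category: the sum of $F,G:\mathscr C\to\mathscr D$ is given by $(F\oplus G)(c)=F(c)\oplus G(c)$, with structure isomorphisms $$(F(c_1)\oplus G(c_1))\oplus(F(c_2)\oplus G(c_2))\cong(F(c_1)\oplus F(c_2))\oplus(G(c_1)\oplus G(c_2))\cong F(c_1\oplus c_2)\oplus G(c_1\oplus c_2),$$ the unit is the constant functor at the unit of $\mathscr D$, the isomorphisms $HF\oplus HG\cong H(F\oplus G)$ and $\mathbf 0\cong H\mathbf 0$ are those of the strong monoidal functor $H$, and the isomorphisms $FH\oplus GH\cong(F\oplus G)H$ and $\mathbf 0\cong\mathbf 0H$ are identities. A *permutative category* is a symmetric monoidal category whose monoidal structure is strictly associative and strictly unital. $\mathbf{Perm}$ is the full sub-$2$-category of $\mathbf{SymMon}$ on the permutative categories, with the inherited structure of an SMC-category. **Proposition 6.1.** The inclusion SMC-functor $\iota:\mathbf{Perm}\hookrightarrow\mathbf{SymMon}$ is a biequivalence of SMC-categories.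 -/

import Mathlib

open CategoryTheory

universe v u w₁ v₁ u₁ w₂ v₂ u₂ w₃ v₃ u₃

set_option linter.unusedVariables false
set_option linter.checkUnivs false

namespace SMC

open MonoidalCategory Functor.LaxMonoidal Functor.OplaxMonoidal Functor.Monoidal

section FunctorSum

variable {C : Type u₁} [Category.{v₁} C] [MonoidalCategory C]
  {D : Type u₂} [Category.{v₂} D] [MonoidalCategory D] [SymmetricCategory D]

/-- The interchange is compatible with the symmetry. -/
theorem braiding_tensorμ (X₁ X₂ Y₁ Y₂ : D) :
    tensorμ X₁ X₂ Y₁ Y₂ ≫ ((β_ X₁ Y₁).hom ⊗ₘ (β_ X₂ Y₂).hom) =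
      (β_ (X₁ ⊗ X₂) (Y₁ ⊗ Y₂)).hom ≫ tensorμ Y₁ Y₂ X₁ X₂ := by
  simp only [tensorμ, BraidedCategory.braiding_tensor_left_hom,
    BraidedCategory.braiding_tensor_right_hom,
    SymmetricCategory.braiding_swap_eq_inv_braiding Y₂ X₁, Category.assoc]
  simp only [tensorHom_def (β_ X₁ Y₁).hom (β_ X₂ Y₂).hom, ← MonoidalCategory.whiskerLeft_comp_assoc,
    ← comp_whiskerRight_assoc, Iso.inv_hom_id, Category.assoc,
    Iso.inv_hom_id_assoc, Iso.hom_inv_id_assoc]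
  monoidal

/-- The interchange of a sum of four objects commutes with exchanging the inner summands. -/
theorem tensorμ_braiding (X₁ X₂ Y₁ Y₂ : D) :
    tensorμ X₁ X₂ Y₁ Y₂ ≫ (β_ (X₁ ⊗ Y₁) (X₂ ⊗ Y₂)).hom =
      ((β_ X₁ X₂).hom ⊗ₘ (β_ Y₁ Y₂).hom) ≫ tensorμ X₂ X₁ Y₂ Y₁ := by
  simp [tensorμ, SymmetricCategory.braiding_swap_eq_inv_braiding Y₁ X₂,
    MonoidalCategory.tensorHom_def]

/-- The pointwise sum `X ↦ F X ⊗ G X` of two symmetric strong monoidal functors is strong monoidal: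
the structure morphism is the interchange
`(F X ⊗ G X) ⊗ (F Y ⊗ G Y) ≅ (F X ⊗ F Y) ⊗ (G X ⊗ G Y)` followed by those of `F` and of `G`. -/
@[reducible]
def tensorFunctorCoreMonoidal (F G : C ⥤ D) [F.Monoidal] [G.Monoidal] :
    (F ⊗ G : C ⥤ D).CoreMonoidal where
  εIso := (λ_ (𝟙_ D)).symm ≪≫ (Functor.Monoidal.εIso F ⊗ᵢ Functor.Monoidal.εIso G)
  μIso X Y :=
    { hom := tensorμ (F.obj X) (G.obj X) (F.obj Y) (G.obj Y) ≫ (μ F X Y ⊗ₘ μ G X Y)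
      inv := (δ F X Y ⊗ₘ δ G X Y) ≫ tensorδ (F.obj X) (G.obj X) (F.obj Y) (G.obj Y)
      hom_inv_id := by simp
      inv_hom_id := by simp }
  μIso_hom_natural_left f X' := by
    change (F.map f ⊗ₘ G.map f) ▷ (F.obj X' ⊗ G.obj X') ≫ tensorμ _ _ _ _ ≫ _ =
      (tensorμ _ _ _ _ ≫ _) ≫ (F.map _ ⊗ₘ G.map _)
    rw [tensorμ_natural_left_assoc, Category.assoc, tensorHom_comp_tensorHom,
      tensorHom_comp_tensorHom, μ_natural_left, μ_natural_left]
  μIso_hom_natural_right X' f := by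
    change (F.obj X' ⊗ G.obj X') ◁ (F.map f ⊗ₘ G.map f) ≫ tensorμ _ _ _ _ ≫ _ =
      (tensorμ _ _ _ _ ≫ _) ≫ (F.map _ ⊗ₘ G.map _)
    rw [tensorμ_natural_right_assoc, Category.assoc, tensorHom_comp_tensorHom,
      tensorHom_comp_tensorHom, μ_natural_right, μ_natural_right]
  associativity X Y Z := by
    change (tensorμ _ _ _ _ ≫ _) ▷ (F.obj Z ⊗ G.obj Z) ≫ (tensorμ _ _ _ _ ≫ _) ≫
        (F.map _ ⊗ₘ G.map _) = (α_ (F.obj X ⊗ G.obj X) (F.obj Y ⊗ G.obj Y) (F.obj Z ⊗ G.obj Z)).hom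
          ≫ (F.obj X ⊗ G.obj X) ◁ (tensorμ _ _ _ _ ≫ _) ≫ tensorμ _ _ _ _ ≫ _
    rw [comp_whiskerRight, MonoidalCategory.whiskerLeft_comp]
    simp only [Category.assoc]
    rw [tensorμ_natural_left_assoc, tensorμ_natural_right_assoc]
    simp only [tensorHom_comp_tensorHom, Functor.LaxMonoidal.associativity]
    rw [← tensorHom_comp_tensorHom, tensor_associativity_assoc]
  left_unitality X := by
    change (λ_ (F.obj X ⊗ G.obj X)).hom = ((λ_ (𝟙_ D)).inv ≫ (ε F ⊗ₘ ε G)) ▷ (F.obj X ⊗ G.obj X) ≫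
      (tensorμ _ _ _ _ ≫ _) ≫ (F.map _ ⊗ₘ G.map _)
    rw [comp_whiskerRight]
    simp only [Category.assoc]
    rw [tensorμ_natural_left_assoc]
    simp only [tensorHom_comp_tensorHom, ← Functor.LaxMonoidal.left_unitality]
    rw [tensor_left_unitality]
  right_unitality X := by
    change (ρ_ (F.obj X ⊗ G.obj X)).hom = (F.obj X ⊗ G.obj X) ◁ ((λ_ (𝟙_ D)).inv ≫ (ε F ⊗ₘ ε G)) ≫
      (tensorμ _ _ _ _ ≫ _) ≫ (F.map _ ⊗ₘ G.map _)
    rw [MonoidalCategory.whiskerLeft_comp]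
    simp only [Category.assoc]
    rw [tensorμ_natural_right_assoc]
    simp only [tensorHom_comp_tensorHom, ← Functor.LaxMonoidal.right_unitality]
    rw [tensor_right_unitality]

instance tensorFunctorMonoidal (F G : C ⥤ D) [F.Monoidal] [G.Monoidal] :
    (F ⊗ G : C ⥤ D).Monoidal :=
  (tensorFunctorCoreMonoidal F G).toMonoidal

theorem tensorFunctor_ε (F G : C ⥤ D) [F.Monoidal] [G.Monoidal] :
    ε (F ⊗ G : C ⥤ D) = (λ_ (𝟙_ D)).inv ≫ (ε F ⊗ₘ ε G) := rfl

theorem tensorFunctor_μ (F G : C ⥤ D) [F.Monoidal] [G.Monoidal] (X Y : C) :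
    μ (F ⊗ G : C ⥤ D) X Y =
      tensorμ (F.obj X) (G.obj X) (F.obj Y) (G.obj Y) ≫ (μ F X Y ⊗ₘ μ G X Y) := rfl

instance tensorFunctorBraided [SymmetricCategory C] (F G : C ⥤ D) [F.Braided] [G.Braided] :
    (F ⊗ G : C ⥤ D).Braided where
  braided X Y := by
    change (tensorμ _ _ _ _ ≫ _) ≫ (F.map _ ⊗ₘ G.map _) =
      (β_ (F.obj X ⊗ G.obj X) (F.obj Y ⊗ G.obj Y)).hom ≫ (tensorμ _ _ _ _ ≫ _)
    rw [Category.assoc, tensorHom_comp_tensorHom, Functor.LaxBraided.braided,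
      Functor.LaxBraided.braided, ← tensorHom_comp_tensorHom, ← Category.assoc, braiding_tensorμ,
      Category.assoc]

end FunctorSum

section ConstantFunctor

variable {C : Type u₁} [Category.{v₁} C] [MonoidalCategory C]
  {D : Type u₂} [Category.{v₂} D] [MonoidalCategory D]

/-- The constant functor at the unit object is symmetric strong monoidal. -/
@[reducible]
def unitFunctorCoreMonoidal : (𝟙_ (C ⥤ D)).CoreMonoidal where
  εIso := Iso.refl (𝟙_ D)
  μIso := fun _ _ => λ_ (𝟙_ D)
  μIso_hom_natural_left f X' := by
    change 𝟙 (𝟙_ D) ▷ (𝟙_ D) ≫ (λ_ (𝟙_ D)).hom = (λ_ (𝟙_ D)).hom ≫ 𝟙 (𝟙_ D)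
    simp
  μIso_hom_natural_right X' f := by
    change (𝟙_ D) ◁ 𝟙 (𝟙_ D) ≫ (λ_ (𝟙_ D)).hom = (λ_ (𝟙_ D)).hom ≫ 𝟙 (𝟙_ D)
    simp
  associativity X Y Z := by
    change (λ_ (𝟙_ D)).hom ▷ (𝟙_ D) ≫ (λ_ (𝟙_ D)).hom ≫ 𝟙 (𝟙_ D) =
      (α_ (𝟙_ D) (𝟙_ D) (𝟙_ D)).hom ≫ (𝟙_ D) ◁ (λ_ (𝟙_ D)).hom ≫ (λ_ (𝟙_ D)).hom
    monoidal
  left_unitality X := by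
    change (λ_ (𝟙_ D)).hom = 𝟙 (𝟙_ D) ▷ (𝟙_ D) ≫ (λ_ (𝟙_ D)).hom ≫ 𝟙 (𝟙_ D)
    simp
  right_unitality X := by
    change (ρ_ (𝟙_ D)).hom = (𝟙_ D) ◁ 𝟙 (𝟙_ D) ≫ (λ_ (𝟙_ D)).hom ≫ 𝟙 (𝟙_ D)
    simp [unitors_equal]

instance unitFunctorMonoidal : (𝟙_ (C ⥤ D)).Monoidal :=
  unitFunctorCoreMonoidal.toMonoidal

theorem unitFunctor_ε : ε (𝟙_ (C ⥤ D)) = 𝟙 (𝟙_ D) := rfl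

theorem unitFunctor_μ (X Y : C) : μ (𝟙_ (C ⥤ D)) X Y = (λ_ (𝟙_ D)).hom := rfl

instance unitFunctorBraided [SymmetricCategory C] [SymmetricCategory D] : (𝟙_ (C ⥤ D)).Braided where
  braided X Y := by
    change (λ_ (𝟙_ D)).hom ≫ 𝟙 (𝟙_ D) = (β_ (𝟙_ D) (𝟙_ D)).hom ≫ (λ_ (𝟙_ D)).hom
    simp [← unitors_equal]

end ConstantFunctor

section Constraints

variable {C : Type u₁} [Category.{v₁} C] [MonoidalCategory C]
  {D : Type u₂} [Category.{v₂} D] [MonoidalCategory D] [SymmetricCategory D]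

theorem isMonoidal_tensorHom {F F' G G' : C ⥤ D} [F.Monoidal] [F'.Monoidal] [G.Monoidal]
    [G'.Monoidal] (α : F ⟶ F') (β : G ⟶ G') (hα : NatTrans.IsMonoidal α)
    (hβ : NatTrans.IsMonoidal β) : NatTrans.IsMonoidal (α ⊗ₘ β) where
  unit := by
    change ((λ_ (𝟙_ D)).inv ≫ (ε F ⊗ₘ ε G)) ≫ (α.app _ ⊗ₘ β.app _) =
      (λ_ (𝟙_ D)).inv ≫ (ε F' ⊗ₘ ε G')
    rw [Category.assoc, tensorHom_comp_tensorHom, hα.unit, hβ.unit]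
  tensor X Y := by
    change (tensorμ _ _ _ _ ≫ (μ F X Y ⊗ₘ μ G X Y)) ≫ (α.app _ ⊗ₘ β.app _) =
      ((α.app X ⊗ₘ β.app X) ⊗ₘ (α.app Y ⊗ₘ β.app Y)) ≫ tensorμ _ _ _ _ ≫ (μ F' X Y ⊗ₘ μ G' X Y)
    rw [Category.assoc, tensorHom_comp_tensorHom, hα.tensor, hβ.tensor, tensorμ_natural_assoc,
      tensorHom_comp_tensorHom]

theorem isMonoidal_whiskerLeft (F : C ⥤ D) {G G' : C ⥤ D} [F.Monoidal] [G.Monoidal]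
    [G'.Monoidal] (β : G ⟶ G') (hβ : NatTrans.IsMonoidal β) : NatTrans.IsMonoidal (F ◁ β) := by
  rw [← id_tensorHom]
  exact isMonoidal_tensorHom _ _ inferInstance hβ

theorem isMonoidal_whiskerRight {F F' : C ⥤ D} (G : C ⥤ D) [F.Monoidal] [F'.Monoidal]
    [G.Monoidal] (α : F ⟶ F') (hα : NatTrans.IsMonoidal α) : NatTrans.IsMonoidal (α ▷ G) := by
  rw [← tensorHom_id]
  exact isMonoidal_tensorHom _ _ hα inferInstance

theorem isMonoidal_associator (F G H : C ⥤ D) [F.Monoidal] [G.Monoidal] [H.Monoidal] :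
    NatTrans.IsMonoidal (α_ F G H).hom where
  unit := by
    change ((λ_ (𝟙_ D)).inv ≫ (((λ_ (𝟙_ D)).inv ≫ (ε F ⊗ₘ ε G)) ⊗ₘ ε H)) ≫ (α_ _ _ _).hom =
      (λ_ (𝟙_ D)).inv ≫ (ε F ⊗ₘ ((λ_ (𝟙_ D)).inv ≫ (ε G ⊗ₘ ε H)))
    rw [← Category.id_comp (ε H), ← tensorHom_comp_tensorHom, Category.id_comp, Category.assoc,
      Category.assoc, associator_naturality, ← Category.id_comp (ε F),
      ← tensorHom_comp_tensorHom, Category.id_comp]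
    simp only [← Category.assoc]
    congr 1
    monoidal
  tensor X Y := by
    change (tensorμ _ _ _ _ ≫ ((tensorμ _ _ _ _ ≫ (μ F X Y ⊗ₘ μ G X Y)) ⊗ₘ μ H X Y)) ≫
        (α_ _ _ _).hom = ((α_ _ _ _).hom ⊗ₘ (α_ _ _ _).hom) ≫ tensorμ _ _ _ _ ≫
          (μ F X Y ⊗ₘ (tensorμ _ _ _ _ ≫ (μ G X Y ⊗ₘ μ H X Y)))
    rw [← Category.id_comp (μ H X Y), ← tensorHom_comp_tensorHom, Category.id_comp, Category.assoc,
      Category.assoc, associator_naturality, ← Category.id_comp (μ F X Y),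
      ← tensorHom_comp_tensorHom, Category.id_comp, tensorHom_id, id_tensorHom,
      associator_monoidal_assoc]

theorem isMonoidal_leftUnitor (F : C ⥤ D) [F.Monoidal] : NatTrans.IsMonoidal (λ_ F).hom where
  unit := by
    change ((λ_ (𝟙_ D)).inv ≫ (𝟙 (𝟙_ D) ⊗ₘ ε F)) ≫ (λ_ _).hom = ε F
    simp
  tensor X Y := by
    change (tensorμ _ _ _ _ ≫ ((λ_ (𝟙_ D)).hom ⊗ₘ μ F X Y)) ≫ (λ_ _).hom =
      ((λ_ (F.obj X)).hom ⊗ₘ (λ_ (F.obj Y)).hom) ≫ μ F X Y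
    rw [leftUnitor_monoidal, MonoidalCategory.tensorHom_def]
    simp only [Category.assoc, leftUnitor_naturality]

theorem isMonoidal_rightUnitor (F : C ⥤ D) [F.Monoidal] : NatTrans.IsMonoidal (ρ_ F).hom where
  unit := by
    change ((λ_ (𝟙_ D)).inv ≫ (ε F ⊗ₘ 𝟙 (𝟙_ D))) ≫ (ρ_ _).hom = ε F
    simp [unitors_inv_equal]
  tensor X Y := by
    change (tensorμ _ _ _ _ ≫ (μ F X Y ⊗ₘ (λ_ (𝟙_ D)).hom)) ≫ (ρ_ _).hom =
      ((ρ_ (F.obj X)).hom ⊗ₘ (ρ_ (F.obj Y)).hom) ≫ μ F X Y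
    rw [rightUnitor_monoidal, MonoidalCategory.tensorHom_def']
    simp only [Category.assoc, rightUnitor_naturality]

theorem isMonoidal_braiding (F G : C ⥤ D) [F.Monoidal] [G.Monoidal] :
    NatTrans.IsMonoidal (β_ F G).hom where
  unit := by
    change ((λ_ (𝟙_ D)).inv ≫ (ε F ⊗ₘ ε G)) ≫ (β_ _ _).hom = (λ_ (𝟙_ D)).inv ≫ (ε G ⊗ₘ ε F)
    rw [Category.assoc, BraidedCategory.braiding_naturality]
    simp [unitors_inv_equal]
  tensor X Y := by
    change (tensorμ _ _ _ _ ≫ (μ F X Y ⊗ₘ μ G X Y)) ≫ (β_ _ _).hom =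
      ((β_ _ _).hom ⊗ₘ (β_ _ _).hom) ≫ tensorμ _ _ _ _ ≫ (μ G X Y ⊗ₘ μ F X Y)
    rw [Category.assoc, BraidedCategory.braiding_naturality, ← Category.assoc,
      tensorμ_braiding, Category.assoc]

end Constraints

section SymMonFunctor

variable {C : Type u₁} [Category.{v₁} C] [MonoidalCategory C] [SymmetricCategory C]
  {D : Type u₂} [Category.{v₂} D] [MonoidalCategory D] [SymmetricCategory D]

variable (C D) in
/-- Symmetric strong monoidal functors. -/
structure SymMonFunctor where
  /-- The underlying functor. -/
  functor : C ⥤ D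
  /-- The symmetric strong monoidal structure. -/
  [braided : functor.Braided]

attribute [instance] SymMonFunctor.braided

namespace SymMonFunctor

/-- Monoidal transformations. -/
@[ext]
structure Hom (F G : SymMonFunctor C D) where
  /-- The underlying natural transformation. -/
  nat : F.functor ⟶ G.functor
  /-- It is compatible with the monoidal structures. -/
  isMonoidal : NatTrans.IsMonoidal nat

instance : Category (SymMonFunctor C D) where
  Hom := Hom
  id F := ⟨𝟙 F.functor, inferInstance⟩
  comp α β := ⟨α.nat ≫ β.nat, by
    have := α.isMonoidal
    have := β.isMonoidal
    infer_instance⟩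

@[ext]
theorem hom_ext {F G : SymMonFunctor C D} {α β : F ⟶ G}
    (h : ∀ X, α.nat.app X = β.nat.app X) : α = β :=
  Hom.ext (NatTrans.ext (funext h))

@[simp]
theorem id_nat (F : SymMonFunctor C D) : (𝟙 F : F ⟶ F).nat = 𝟙 F.functor := rfl

@[simp]
theorem comp_nat {F G H : SymMonFunctor C D} (α : F ⟶ G) (β : G ⟶ H) :
    (α ≫ β).nat = α.nat ≫ β.nat := rfl

/-- A monoidal natural isomorphism is an isomorphism of symmetric strong monoidal functors. -/
@[simps]
def isoMk {F G : SymMonFunctor C D} (e : F.functor ≅ G.functor)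
    (h : NatTrans.IsMonoidal e.hom) : F ≅ G where
  hom := ⟨e.hom, h⟩
  inv := ⟨e.inv, inferInstance⟩

/-- The sum of symmetric strong monoidal functors is formed pointwise, with the structure maps of
`tensorFunctorMonoidal`; the unit is the constant functor at the unit object, and the constraints
are those of `D`. -/
instance : MonoidalCategoryStruct (SymMonFunctor C D) where
  tensorObj F G := ⟨F.functor ⊗ G.functor⟩
  tensorUnit := ⟨𝟙_ (C ⥤ D)⟩
  tensorHom α β := ⟨α.nat ⊗ₘ β.nat, isMonoidal_tensorHom _ _ α.isMonoidal β.isMonoidal⟩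
  whiskerLeft F _ _ α := ⟨F.functor ◁ α.nat, isMonoidal_whiskerLeft _ _ α.isMonoidal⟩
  whiskerRight α F := ⟨α.nat ▷ F.functor, isMonoidal_whiskerRight _ _ α.isMonoidal⟩
  associator F G H := isoMk (α_ F.functor G.functor H.functor) (isMonoidal_associator _ _ _)
  leftUnitor F := isoMk (λ_ F.functor) (isMonoidal_leftUnitor _)
  rightUnitor F := isoMk (ρ_ F.functor) (isMonoidal_rightUnitor _)

instance : MonoidalCategory (SymMonFunctor C D) where
  tensorHom_def _ _ := Hom.ext (MonoidalCategory.tensorHom_def _ _)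
  id_tensorHom_id _ _ := Hom.ext (MonoidalCategory.id_tensorHom_id _ _)
  tensorHom_comp_tensorHom _ _ _ _ := Hom.ext (MonoidalCategory.tensorHom_comp_tensorHom _ _ _ _)
  whiskerLeft_id _ _ := Hom.ext (MonoidalCategory.whiskerLeft_id _ _)
  id_whiskerRight _ _ := Hom.ext (MonoidalCategory.id_whiskerRight _ _)
  associator_naturality _ _ _ := Hom.ext (MonoidalCategory.associator_naturality _ _ _)
  leftUnitor_naturality _ := Hom.ext (MonoidalCategory.leftUnitor_naturality _)
  rightUnitor_naturality _ := Hom.ext (MonoidalCategory.rightUnitor_naturality _)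
  pentagon _ _ _ _ := Hom.ext (MonoidalCategory.pentagon _ _ _ _)
  triangle _ _ := Hom.ext (MonoidalCategory.triangle _ _)

instance : SymmetricCategory (SymMonFunctor C D) where
  braiding F G := isoMk (β_ F.functor G.functor) (isMonoidal_braiding _ _)
  braiding_naturality_right _ _ _ _ := Hom.ext (BraidedCategory.braiding_naturality_right _ _)
  braiding_naturality_left _ _ := Hom.ext (BraidedCategory.braiding_naturality_left _ _)
  hexagon_forward _ _ _ := Hom.ext (BraidedCategory.hexagon_forward _ _ _)
  hexagon_reverse _ _ _ := Hom.ext (BraidedCategory.hexagon_reverse _ _ _)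
  symmetry _ _ := Hom.ext (SymmetricCategory.symmetry _ _)

end SymMonFunctor

end SymMonFunctor

section SymMon

/-- Symmetric monoidal categories. -/
structure SymMon where
  /-- The type of objects. -/
  carrier : Type u
  /-- The morphisms. -/
  [category : Category.{v} carrier]
  /-- The monoidal structure. -/
  [monoidal : MonoidalCategory carrier]
  /-- The symmetry. -/
  [symmetric : SymmetricCategory carrier]

attribute [instance] SymMon.category SymMon.monoidal SymMon.symmetric

namespace SymMonFunctor

variable {A : Type u} [Category.{v} A] [MonoidalCategory A] [SymmetricCategory A]
  {B : Type u₁} [Category.{v₁} B] [MonoidalCategory B] [SymmetricCategory B]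
  {C : Type u₂} [Category.{v₂} C] [MonoidalCategory C] [SymmetricCategory C]
  {D : Type u₃} [Category.{v₃} D] [MonoidalCategory D] [SymmetricCategory D]

variable (A) in
/-- The identity functor. -/
def idFunctor : SymMonFunctor A A where
  functor := 𝟭 A

/-- Composition of symmetric strong monoidal functors, in diagrammatic order. -/
def compFunctor (F : SymMonFunctor A B) (G : SymMonFunctor B C) : SymMonFunctor A C where
  functor := F.functor ⋙ G.functor

/-- Whiskering a monoidal transformation on the left. -/
def whiskerLeftHom (F : SymMonFunctor A B) {G G' : SymMonFunctor B C} (α : G ⟶ G') :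
    F.compFunctor G ⟶ F.compFunctor G' where
  nat := Functor.whiskerLeft F.functor α.nat
  isMonoidal := by
    have := α.isMonoidal
    exact NatTrans.IsMonoidal.whiskerLeft α.nat

/-- Whiskering a monoidal transformation on the right. -/
def whiskerRightHom {F F' : SymMonFunctor A B} (α : F ⟶ F') (G : SymMonFunctor B C) :
    F.compFunctor G ⟶ F'.compFunctor G where
  nat := Functor.whiskerRight α.nat G.functor
  isMonoidal := by
    have := α.isMonoidal
    exact NatTrans.IsMonoidal.whiskerRight α.nat

/-- The associator, with identity components. -/
def associatorIso (F : SymMonFunctor A B) (G : SymMonFunctor B C) (H : SymMonFunctor C D) :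
    (F.compFunctor G).compFunctor H ≅ F.compFunctor (G.compFunctor H) :=
  isoMk (Functor.associator F.functor G.functor H.functor)
    { unit := by
        change (ε H.functor ≫ H.functor.map (ε G.functor ≫ G.functor.map (ε F.functor))) ≫ 𝟙 _ =
          (ε H.functor ≫ H.functor.map (ε G.functor)) ≫
            H.functor.map (G.functor.map (ε F.functor))
        simp
      tensor := fun X Y => by
        change (μ H.functor _ _ ≫ H.functor.map (μ G.functor _ _ ≫
            G.functor.map (μ F.functor X Y))) ≫ 𝟙 _ =
          (𝟙 _ ⊗ₘ 𝟙 _) ≫ (μ H.functor _ _ ≫ H.functor.map (μ G.functor _ _)) ≫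
            H.functor.map (G.functor.map (μ F.functor X Y))
        simp }

/-- The left unitor, with identity components. -/
def leftUnitorIso (F : SymMonFunctor A B) : (idFunctor A).compFunctor F ≅ F :=
  isoMk F.functor.leftUnitor
    { unit := by
        change (ε F.functor ≫ F.functor.map (𝟙 _)) ≫ 𝟙 _ = ε F.functor
        simp
      tensor := fun X Y => by
        change (μ F.functor X Y ≫ F.functor.map (𝟙 _)) ≫ 𝟙 _ = (𝟙 _ ⊗ₘ 𝟙 _) ≫ μ F.functor X Y
        simp }

/-- The right unitor, with identity components. -/
def rightUnitorIso (F : SymMonFunctor A B) : F.compFunctor (idFunctor B) ≅ F :=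
  isoMk F.functor.rightUnitor
    { unit := by
        change (𝟙 _ ≫ ε F.functor) ≫ 𝟙 _ = ε F.functor
        simp
      tensor := fun X Y => by
        change (𝟙 _ ≫ μ F.functor X Y) ≫ 𝟙 _ = (𝟙 _ ⊗ₘ 𝟙 _) ≫ μ F.functor X Y
        simp }

end SymMonFunctor

open SymMonFunctor in
/-- The 2-category of symmetric monoidal categories, symmetric strong monoidal functors and
monoidal transformations. -/
instance : Bicategory SymMon.{v, u} where
  Hom C D := SymMonFunctor C.carrier D.carrier
  id C := idFunctor C.carrier
  comp F G := compFunctor F G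
  whiskerLeft F _ _ α := whiskerLeftHom F α
  whiskerRight α G := whiskerRightHom α G
  associator F G H := associatorIso F G H
  leftUnitor F := leftUnitorIso F
  rightUnitor F := rightUnitorIso F
  whiskerLeft_id F G := Hom.ext (Functor.whiskerLeft_id' F.functor)
  whiskerLeft_comp F _ _ _ α β := Hom.ext (Functor.whiskerLeft_comp F.functor (Hom.nat α) (Hom.nat β))
  id_whiskerLeft α := Hom.ext <| NatTrans.ext <| funext fun _ =>
    ((Category.id_comp _).trans (Category.comp_id _)).symm
  comp_whiskerLeft F G _ _ α := Hom.ext <| NatTrans.ext <| funext fun _ =>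
    ((Category.id_comp _).trans (Category.comp_id _)).symm
  id_whiskerRight F G := Hom.ext (Functor.whiskerRight_id' G.functor)
  comp_whiskerRight α β G := Hom.ext (Functor.whiskerRight_comp (Hom.nat α) (Hom.nat β) G.functor)
  whiskerRight_id α := Hom.ext <| NatTrans.ext <| funext fun _ =>
    ((Category.id_comp _).trans (Category.comp_id _)).symm
  whiskerRight_comp α G H := Hom.ext <| NatTrans.ext <| funext fun _ =>
    ((Category.id_comp _).trans (Category.comp_id _)).symm
  whisker_assoc F _ _ α H := Hom.ext <| NatTrans.ext <| funext fun _ =>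
    ((Category.id_comp _).trans (Category.comp_id _)).symm
  whisker_exchange α β := Hom.ext <| NatTrans.ext <| funext fun X =>
    ((Hom.nat β).naturality ((Hom.nat α).app X)).symm
  pentagon F G H K := Hom.ext (Functor.pentagon F.functor G.functor H.functor K.functor)
  triangle F G := Hom.ext (Functor.triangle F.functor G.functor)

end SymMon

section SMCCategory

/-- An SMC-category: a bicategory `B` with a symmetric monoidal structure on every category
`a ⟶ b` such that composition is bilinear. The sum of 1-cells is written `⊗` and the zero 1-cell
`𝟙_ (a ⟶ b)`; composition is in diagrammatic order, so that `postcomp a g` is `g ∘ -` and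
`precomp c f` is `- ∘ f`. -/
class SMCCategory (B : Type u) [Bicategory.{v₁, v} B] where
  /-- The sum on the category of 1-cells `a ⟶ b`. -/
  [homMonoidal : ∀ a b : B, MonoidalCategory (a ⟶ b)]
  /-- The symmetry of the sum. -/
  [homSymmetric : ∀ a b : B, SymmetricCategory (a ⟶ b)]
  /-- Every `g ∘ -` is symmetric strong monoidal: `g ∘ f ⊕ g ∘ f' ≅ g ∘ (f ⊕ f')` and
  `0 ≅ g ∘ 0`. -/
  [postcompBraided : ∀ (a : B) {b c : B} (g : b ⟶ c), (Bicategory.postcomp a g).Braided]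
  /-- Every `- ∘ f` is symmetric strong monoidal: `g ∘ f ⊕ g' ∘ f ≅ (g ⊕ g') ∘ f` and
  `0 ≅ 0 ∘ f`. -/
  [precompBraided : ∀ {a b : B} (f : a ⟶ b) (c : B), (Bicategory.precomp c f).Braided]
  /-- The structure isomorphisms of `g ∘ -` are natural in `g`. -/
  postcomposing_isMonoidal : ∀ (a : B) {b c : B} {g g' : b ⟶ c} (η : g ⟶ g'),
    NatTrans.IsMonoidal (F₁ := Bicategory.postcomp a g) (F₂ := Bicategory.postcomp a g')
      ((Bicategory.postcomposing a b c).map η)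
  /-- The structure isomorphisms of `- ∘ f` are natural in `f`. -/
  precomposing_isMonoidal : ∀ {a b : B} {f f' : a ⟶ b} (η : f ⟶ f') (c : B),
    NatTrans.IsMonoidal (F₁ := Bicategory.precomp c f) (F₂ := Bicategory.precomp c f')
      ((Bicategory.precomposing a b c).map η)
  /-- The two ways of distributing `(g ⊕ g') ∘ (f ⊕ f')` agree. This says both that
  `(g ∘ -) ⊕ (g' ∘ -) ≅ (g ⊕ g') ∘ -` and that `(- ∘ f) ⊕ (- ∘ f') ≅ - ∘ (f ⊕ f')` respect
  binary sums. -/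
  sum_comp_sum : ∀ {a b c : B} (f f' : a ⟶ b) (g g' : b ⟶ c),
    tensorμ (f ≫ g) (f ≫ g') (f' ≫ g) (f' ≫ g') ≫
        (μ (Bicategory.postcomp a g) f f' ⊗ₘ μ (Bicategory.postcomp a g') f f') ≫
          μ (Bicategory.precomp c (f ⊗ f')) g g' =
      (μ (Bicategory.precomp c f) g g' ⊗ₘ μ (Bicategory.precomp c f') g g') ≫
        μ (Bicategory.postcomp a (g ⊗ g')) f f'
  /-- `(g ∘ -) ⊕ (g' ∘ -) ≅ (g ⊕ g') ∘ -` respects zero objects, and `0 ≅ - ∘ 0` respects binary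
  sums. -/
  zero_comp_sum : ∀ (a : B) {b c : B} (g g' : b ⟶ c),
    (λ_ (𝟙_ (a ⟶ c))).inv ≫
        (ε (Bicategory.postcomp a g) ⊗ₘ ε (Bicategory.postcomp a g')) ≫
          μ (Bicategory.precomp c (𝟙_ (a ⟶ b))) g g' =
      ε (Bicategory.postcomp a (g ⊗ g'))
  /-- `(- ∘ f) ⊕ (- ∘ f') ≅ - ∘ (f ⊕ f')` respects zero objects, and `0 ≅ 0 ∘ -` respects binary
  sums. -/
  sum_comp_zero : ∀ {a b : B} (f f' : a ⟶ b) (c : B),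
    (λ_ (𝟙_ (a ⟶ c))).inv ≫
        (ε (Bicategory.precomp c f) ⊗ₘ ε (Bicategory.precomp c f')) ≫
          μ (Bicategory.postcomp a (𝟙_ (b ⟶ c))) f f' =
      ε (Bicategory.precomp c (f ⊗ f'))
  /-- `0 ≅ 0 ∘ -` and `0 ≅ - ∘ 0` respect zero objects. -/
  zero_comp_zero : ∀ (a b c : B),
    ε (Bicategory.precomp c (𝟙_ (a ⟶ b))) = ε (Bicategory.postcomp a (𝟙_ (b ⟶ c)))
  /-- `h ∘ (g ∘ -) ≅ (h ∘ g) ∘ -` is monoidal. -/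
  associatorLeft_isMonoidal : ∀ (a : B) {b c d : B} (g : b ⟶ c) (h : c ⟶ d),
    NatTrans.IsMonoidal (F₁ := Bicategory.postcomp a g ⋙ Bicategory.postcomp a h)
      (F₂ := Bicategory.postcomp a (g ≫ h)) (Bicategory.associatorNatIsoLeft a g h).hom
  /-- `h ∘ (- ∘ f) ≅ (h ∘ -) ∘ f` is monoidal. -/
  associatorMiddle_isMonoidal : ∀ {a b c d : B} (f : a ⟶ b) (h : c ⟶ d),
    NatTrans.IsMonoidal (F₁ := Bicategory.precomp c f ⋙ Bicategory.postcomp a h)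
      (F₂ := Bicategory.postcomp b h ⋙ Bicategory.precomp d f)
      (Bicategory.associatorNatIsoMiddle f h).hom
  /-- `- ∘ (g ∘ f) ≅ (- ∘ g) ∘ f` is monoidal. -/
  associatorRight_isMonoidal : ∀ {a b c : B} (f : a ⟶ b) (g : b ⟶ c) (d : B),
    NatTrans.IsMonoidal (F₁ := Bicategory.precomp d (f ≫ g))
      (F₂ := Bicategory.precomp d g ⋙ Bicategory.precomp d f)
      (Bicategory.associatorNatIsoRight f g d).hom
  /-- `- ∘ 1 ≅ id` is monoidal. -/
  leftUnitor_isMonoidal : ∀ a b : B,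
    NatTrans.IsMonoidal (F₁ := Bicategory.precomp b (𝟙 a)) (F₂ := 𝟭 (a ⟶ b))
      (Bicategory.leftUnitorNatIso a b).hom
  /-- `1 ∘ - ≅ id` is monoidal. -/
  rightUnitor_isMonoidal : ∀ a b : B,
    NatTrans.IsMonoidal (F₁ := Bicategory.postcomp a (𝟙 b)) (F₂ := 𝟭 (a ⟶ b))
      (Bicategory.rightUnitorNatIso a b).hom

attribute [reducible, instance] SMCCategory.homMonoidal SMCCategory.homSymmetric
  SMCCategory.postcompBraided SMCCategory.precompBraided

end SMCCategory

section SymMonSMC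

section

variable {B : Type u₁} [Category.{v₁} B] [MonoidalCategory B]
  {C : Type u₂} [Category.{v₂} C] [MonoidalCategory C] (G : B ⥤ C) [G.LaxMonoidal]

theorem leftUnitor_inv_ε_ε_μ :
    (λ_ (𝟙_ C)).inv ≫ (ε G ⊗ₘ ε G) ≫ μ G _ _ = ε G ≫ G.map (λ_ (𝟙_ B)).inv := by
  rw [MonoidalCategory.tensorHom_def', Category.assoc, ← leftUnitor_inv_naturality_assoc,
    Functor.LaxMonoidal.left_unitality_inv]

theorem id_tensorHom_id_comp {X Y Z : C} (f : X ⊗ Y ⟶ Z) : (𝟙 X ⊗ₘ 𝟙 Y) ≫ f = f := by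
  simp

theorem leftUnitor_ε :
    (λ_ (𝟙_ C)).hom ≫ ε G = (ε G ⊗ₘ ε G) ≫ μ G _ _ ≫ G.map (λ_ (𝟙_ B)).hom := by
  rw [MonoidalCategory.tensorHom_def', Category.assoc, ← Functor.LaxMonoidal.left_unitality,
    leftUnitor_naturality]

end

namespace SymMonFunctor

variable {A : Type u} [Category.{v} A] [MonoidalCategory A] [SymmetricCategory A]
  {B : Type u₁} [Category.{v₁} B] [MonoidalCategory B] [SymmetricCategory B]
  {C : Type u₂} [Category.{v₂} C] [MonoidalCategory C] [SymmetricCategory C]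

/-- `G ∘ F ⊕ G ∘ F' ≅ G ∘ (F ⊕ F')` is given by the structure morphisms of `G`. -/
def compSumIso (F F' : SymMonFunctor A B) (G : SymMonFunctor B C) :
    F.compFunctor G ⊗ F'.compFunctor G ≅ (F ⊗ F').compFunctor G :=
  isoMk
    (NatIso.ofComponents
      (F := (F.compFunctor G ⊗ F'.compFunctor G).functor) (G := ((F ⊗ F').compFunctor G).functor)
      (fun X => μIso G.functor (F.functor.obj X) (F'.functor.obj X))
      (fun {X Y} f => by
        change (G.functor.map (F.functor.map f) ⊗ₘ G.functor.map (F'.functor.map f)) ≫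
            μ G.functor _ _ =
          μ G.functor _ _ ≫ G.functor.map (F.functor.map f ⊗ₘ F'.functor.map f)
        simp))
    { unit := by
        change ((λ_ (𝟙_ C)).inv ≫ ((ε G.functor ≫ G.functor.map (ε F.functor)) ⊗ₘ
            (ε G.functor ≫ G.functor.map (ε F'.functor)))) ≫ μ G.functor _ _ =
          ε G.functor ≫ G.functor.map ((λ_ (𝟙_ B)).inv ≫ (ε F.functor ⊗ₘ ε F'.functor))
        rw [← tensorHom_comp_tensorHom, Category.assoc, Category.assoc, μ_natural,
          Functor.map_comp, ← Category.assoc (ε G.functor), ← leftUnitor_inv_ε_ε_μ,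
          Category.assoc, Category.assoc]
      tensor := fun X Y => by
        change (tensorμ _ _ _ _ ≫ ((μ G.functor _ _ ≫ G.functor.map (μ F.functor X Y)) ⊗ₘ
            (μ G.functor _ _ ≫ G.functor.map (μ F'.functor X Y)))) ≫ μ G.functor _ _ =
          (μ G.functor _ _ ⊗ₘ μ G.functor _ _) ≫ μ G.functor _ _ ≫
            G.functor.map (tensorμ _ _ _ _ ≫ (μ F.functor X Y ⊗ₘ μ F'.functor X Y))
        rw [← tensorHom_comp_tensorHom, Functor.map_comp, ← tensorμ_comp_μ_tensorHom_μ_comp_μ_assoc,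
          Category.assoc, Category.assoc, μ_natural] }

/-- `0 ≅ G ∘ 0` is given by the unit morphism of `G`. -/
def compZeroIso (A : Type u) [Category.{v} A] [MonoidalCategory A] [SymmetricCategory A]
    (G : SymMonFunctor B C) :
    𝟙_ (SymMonFunctor A C) ≅ (𝟙_ (SymMonFunctor A B)).compFunctor G :=
  isoMk
    (NatIso.ofComponents
      (F := (𝟙_ (SymMonFunctor A C)).functor)
      (G := ((𝟙_ (SymMonFunctor A B)).compFunctor G).functor)
      (fun _ => εIso G.functor)
      (fun {X Y} f => by
        change 𝟙 (𝟙_ C) ≫ ε G.functor = ε G.functor ≫ G.functor.map (𝟙 (𝟙_ B))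
        simp))
    { unit := by
        change 𝟙 (𝟙_ C) ≫ ε G.functor = ε G.functor ≫ G.functor.map (𝟙 (𝟙_ B))
        simp
      tensor := fun X Y => by
        change (λ_ (𝟙_ C)).hom ≫ ε G.functor =
          (ε G.functor ⊗ₘ ε G.functor) ≫ μ G.functor _ _ ≫ G.functor.map (λ_ (𝟙_ B)).hom
        exact leftUnitor_ε G.functor }

/-- `G ∘ F ⊕ G' ∘ F ≅ (G ⊕ G') ∘ F` has identity components. -/
def sumCompIso (F : SymMonFunctor A B) (G G' : SymMonFunctor B C) :
    F.compFunctor G ⊗ F.compFunctor G' ≅ F.compFunctor (G ⊗ G') :=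
  isoMk
    (NatIso.ofComponents
      (F := (F.compFunctor G ⊗ F.compFunctor G').functor) (G := (F.compFunctor (G ⊗ G')).functor)
      (fun X => Iso.refl (G.functor.obj (F.functor.obj X) ⊗ G'.functor.obj (F.functor.obj X)))
      (fun {X Y} f => (Category.comp_id _).trans (Category.id_comp _).symm))
    { unit := by
        change ((λ_ (𝟙_ C)).inv ≫ ((ε G.functor ≫ G.functor.map (ε F.functor)) ⊗ₘ
            (ε G'.functor ≫ G'.functor.map (ε F.functor)))) ≫ 𝟙 _ =
          ((λ_ (𝟙_ C)).inv ≫ (ε G.functor ⊗ₘ ε G'.functor)) ≫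
            (G.functor.map (ε F.functor) ⊗ₘ G'.functor.map (ε F.functor))
        simp
      tensor := fun X Y => by
        change (tensorμ _ _ _ _ ≫ ((μ G.functor _ _ ≫ G.functor.map (μ F.functor X Y)) ⊗ₘ
            (μ G'.functor _ _ ≫ G'.functor.map (μ F.functor X Y)))) ≫ 𝟙 _ =
          (𝟙 _ ⊗ₘ 𝟙 _) ≫ (tensorμ _ _ _ _ ≫ (μ G.functor _ _ ⊗ₘ μ G'.functor _ _)) ≫
            (G.functor.map (μ F.functor X Y) ⊗ₘ G'.functor.map (μ F.functor X Y))
        simp }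

/-- `0 ≅ 0 ∘ F` has identity components. -/
def zeroCompIso (F : SymMonFunctor A B) (C : Type u₂) [Category.{v₂} C] [MonoidalCategory C]
    [SymmetricCategory C] :
    𝟙_ (SymMonFunctor A C) ≅ F.compFunctor (𝟙_ (SymMonFunctor B C)) :=
  isoMk
    (NatIso.ofComponents
      (F := (𝟙_ (SymMonFunctor A C)).functor)
      (G := (F.compFunctor (𝟙_ (SymMonFunctor B C))).functor)
      (fun _ => Iso.refl (𝟙_ C))
      (fun {X Y} f => rfl))
    { unit := rfl
      tensor := fun X Y => by
        change (λ_ (𝟙_ C)).hom ≫ 𝟙 _ = (𝟙 _ ⊗ₘ 𝟙 _) ≫ (λ_ (𝟙_ C)).hom ≫ 𝟙 _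
        simp }

end SymMonFunctor

namespace SymMon

open SymMonFunctor

instance homMonoidal (C D : SymMon.{v, u}) : MonoidalCategory (C ⟶ D) :=
  inferInstanceAs (MonoidalCategory (SymMonFunctor C.carrier D.carrier))

instance homSymmetric (C D : SymMon.{v, u}) : SymmetricCategory (C ⟶ D) :=
  inferInstanceAs (SymmetricCategory (SymMonFunctor C.carrier D.carrier))

variable {A B C : SymMon.{v, u}}

instance postcompMonoidal (A : SymMon.{v, u}) (G : B ⟶ C) :
    (Bicategory.postcomp A G).Monoidal :=
  Functor.CoreMonoidal.toMonoidal
    { εIso := compZeroIso A.carrier G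
      μIso F F' := compSumIso F F' G
      μIso_hom_natural_left α F' := Hom.ext <| NatTrans.ext <| funext fun _ =>
        μ_natural_left (SymMonFunctor.functor G) _ _
      μIso_hom_natural_right F' α := Hom.ext <| NatTrans.ext <| funext fun _ =>
        μ_natural_right (SymMonFunctor.functor G) _ _
      associativity F F' F'' := Hom.ext <| NatTrans.ext <| funext fun _ =>
        Functor.LaxMonoidal.associativity (SymMonFunctor.functor G) _ _ _
      left_unitality F := Hom.ext <| NatTrans.ext <| funext fun _ =>
        Functor.LaxMonoidal.left_unitality (SymMonFunctor.functor G) _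
      right_unitality F := Hom.ext <| NatTrans.ext <| funext fun _ =>
        Functor.LaxMonoidal.right_unitality (SymMonFunctor.functor G) _ }

instance postcompBraided (A : SymMon.{v, u}) (G : B ⟶ C) :
    (Bicategory.postcomp A G).Braided where
  braided F F' := Hom.ext <| NatTrans.ext <| funext fun _ =>
    Functor.LaxBraided.braided (F := SymMonFunctor.functor G) _ _

instance precompMonoidal (F : A ⟶ B) (C : SymMon.{v, u}) :
    (Bicategory.precomp C F).Monoidal :=
  Functor.CoreMonoidal.toMonoidal
    { εIso := zeroCompIso F C.carrier
      μIso G G' := sumCompIso F G G'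
      μIso_hom_natural_left α F' := Hom.ext <| NatTrans.ext <| funext fun _ =>
        (Category.comp_id _).trans (Category.id_comp _).symm
      μIso_hom_natural_right F' α := Hom.ext <| NatTrans.ext <| funext fun _ =>
        (Category.comp_id _).trans (Category.id_comp _).symm
      associativity G G' G'' := Hom.ext <| NatTrans.ext <| funext fun X => by
        change 𝟙 _ ▷ _ ≫ 𝟙 _ ≫ (α_ _ _ _).hom = (α_ _ _ _).hom ≫ _ ◁ 𝟙 _ ≫ 𝟙 _
        rw [id_whiskerRight, MonoidalCategory.whiskerLeft_id]
        simp
      left_unitality G := Hom.ext <| NatTrans.ext <| funext fun X => by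
        change (λ_ _).hom = 𝟙 _ ▷ _ ≫ 𝟙 _ ≫ (λ_ _).hom
        rw [id_whiskerRight]
        simp
      right_unitality G := Hom.ext <| NatTrans.ext <| funext fun X => by
        change (ρ_ _).hom = _ ◁ 𝟙 _ ≫ 𝟙 _ ≫ (ρ_ _).hom
        rw [MonoidalCategory.whiskerLeft_id]
        simp }

instance precompBraided (F : A ⟶ B) (C : SymMon.{v, u}) :
    (Bicategory.precomp C F).Braided where
  braided G G' := Hom.ext <| NatTrans.ext <| funext fun _ =>
    (Category.id_comp _).trans (Category.comp_id _).symm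

/-- Symmetric monoidal categories form an SMC-category. -/
instance : SMCCategory SymMon.{v, u} where
  postcomposing_isMonoidal A _ _ G G' α :=
    { unit := Hom.ext <| NatTrans.ext <| funext fun _ => (Hom.isMonoidal α).unit
      tensor := fun F F' => Hom.ext <| NatTrans.ext <| funext fun _ =>
        (Hom.isMonoidal α).tensor _ _ }
  precomposing_isMonoidal {_ _ F F'} α C :=
    { unit := Hom.ext <| NatTrans.ext <| funext fun _ => Category.id_comp (𝟙 (𝟙_ C.carrier))
      tensor := fun G G' => Hom.ext <| NatTrans.ext <| funext fun _ =>
        (Category.id_comp _).trans (Category.comp_id _).symm }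
  sum_comp_sum F F' G G' := Hom.ext <| NatTrans.ext <| funext fun _ =>
    (congrArg _ (Category.comp_id _)).trans (id_tensorHom_id_comp _).symm
  zero_comp_sum A _ _ G G' := Hom.ext <| NatTrans.ext <| funext fun _ =>
    congrArg _ (Category.comp_id _)
  sum_comp_zero F F' C := Hom.ext <| NatTrans.ext <| funext fun X => by
    change (λ_ (𝟙_ C.carrier)).inv ≫ (𝟙 _ ⊗ₘ 𝟙 _) ≫ (λ_ (𝟙_ C.carrier)).hom = 𝟙 _
    simp
  zero_comp_zero A B C := rfl
  associatorLeft_isMonoidal A _ _ _ G H :=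
    { unit := Hom.ext <| NatTrans.ext <| funext fun _ => Category.comp_id _
      tensor := fun F F' => Hom.ext <| NatTrans.ext <| funext fun _ =>
        (Category.comp_id _).trans (id_tensorHom_id_comp _).symm }
  associatorMiddle_isMonoidal F H :=
    { unit := Hom.ext <| NatTrans.ext <| funext fun _ => by
        change (ε (SymMonFunctor.functor H) ≫ (SymMonFunctor.functor H).map (𝟙 _)) ≫ 𝟙 _ =
          𝟙 _ ≫ ε (SymMonFunctor.functor H)
        simp
      tensor := fun G G' => Hom.ext <| NatTrans.ext <| funext fun X => by
        change (μ (SymMonFunctor.functor H) _ _ ≫ (SymMonFunctor.functor H).map (𝟙 _)) ≫ 𝟙 _ =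
          (𝟙 _ ⊗ₘ 𝟙 _) ≫ 𝟙 _ ≫ μ (SymMonFunctor.functor H) _ _
        simp }
  associatorRight_isMonoidal F G D :=
    { unit := Hom.ext <| NatTrans.ext <| funext fun _ => rfl
      tensor := fun H H' => Hom.ext <| NatTrans.ext <| funext fun _ =>
        (id_tensorHom_id_comp _).symm }
  leftUnitor_isMonoidal A B :=
    { unit := Hom.ext <| NatTrans.ext <| funext fun _ => Category.comp_id (𝟙 (𝟙_ B.carrier))
      tensor := fun H H' => Hom.ext <| NatTrans.ext <| funext fun _ =>
        (Category.comp_id _).trans (id_tensorHom_id_comp _).symm }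
  rightUnitor_isMonoidal A B :=
    { unit := Hom.ext <| NatTrans.ext <| funext fun _ => Category.comp_id (𝟙 (𝟙_ B.carrier))
      tensor := fun H H' => Hom.ext <| NatTrans.ext <| funext fun _ =>
        (Category.comp_id _).trans (id_tensorHom_id_comp _).symm }

end SymMon

end SymMonSMC

section Transformations

variable {A : Type u} [Category.{v} A] [MonoidalCategory A]
  {B : Type u₁} [Category.{v₁} B] [MonoidalCategory B]
  {C : Type u₂} [Category.{v₂} C] [MonoidalCategory C]
  {D : Type u₃} [Category.{v₃} D] [MonoidalCategory D]

theorem isMonoidal_congr {F G : A ⥤ B} [F.LaxMonoidal] [G.LaxMonoidal] {α β : F ⟶ G}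
    (h : NatTrans.IsMonoidal α) (e : ∀ X, α.app X = β.app X) : NatTrans.IsMonoidal β := by
  have : α = β := NatTrans.ext (funext e)
  rwa [← this]

theorem isMonoidal_comp {F G H : A ⥤ B} [F.LaxMonoidal] [G.LaxMonoidal] [H.LaxMonoidal]
    (α : F ⟶ G) (β : G ⟶ H) (hα : NatTrans.IsMonoidal α) (hβ : NatTrans.IsMonoidal β) :
    NatTrans.IsMonoidal (α ≫ β) :=
  inferInstance

theorem isMonoidal_iso_inv {F G : A ⥤ B} [F.LaxMonoidal] [G.LaxMonoidal] (e : F ≅ G)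
    (h : NatTrans.IsMonoidal e.hom) : NatTrans.IsMonoidal e.inv :=
  inferInstance

theorem isMonoidal_whiskerLeft_functor (F : A ⥤ B) {G H : B ⥤ C} [F.LaxMonoidal]
    [G.LaxMonoidal] [H.LaxMonoidal] (α : G ⟶ H) (hα : NatTrans.IsMonoidal α) :
    NatTrans.IsMonoidal (Functor.whiskerLeft F α) :=
  NatTrans.IsMonoidal.whiskerLeft α

theorem isMonoidal_whiskerRight_functor {F G : A ⥤ B} (α : F ⟶ G) (H : B ⥤ C) [F.LaxMonoidal]
    [G.LaxMonoidal] [H.LaxMonoidal] (hα : NatTrans.IsMonoidal α) :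
    NatTrans.IsMonoidal (Functor.whiskerRight α H) :=
  NatTrans.IsMonoidal.whiskerRight α

theorem isMonoidal_associator_functor_hom (F : A ⥤ B) (G : B ⥤ C) (H : C ⥤ D) [F.LaxMonoidal]
    [G.LaxMonoidal] [H.LaxMonoidal] : NatTrans.IsMonoidal (Functor.associator F G H).hom :=
  inferInstance

theorem isMonoidal_associator_functor_inv (F : A ⥤ B) (G : B ⥤ C) (H : C ⥤ D) [F.LaxMonoidal]
    [G.LaxMonoidal] [H.LaxMonoidal] : NatTrans.IsMonoidal (Functor.associator F G H).inv :=
  inferInstance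

theorem isMonoidal_rightUnitor_functor (F : A ⥤ B) [F.LaxMonoidal] :
    NatTrans.IsMonoidal F.rightUnitor.hom :=
  inferInstance

theorem isMonoidal_leftUnitor_functor_inv (F : A ⥤ B) [F.LaxMonoidal] :
    NatTrans.IsMonoidal F.leftUnitor.inv :=
  inferInstance

end Transformations

section SMCFunctor

open Pseudofunctor.StrongTrans

variable {B : Type u₁} [Bicategory.{w₁, v₁} B] {C : Type u₂} [Bicategory.{w₂, v₂} C]

/-- The constraint `F (g ∘ f) ≅ F g ∘ F f` as a natural transformation in the variable `g`. -/
@[simps]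
def mapCompNatLeft (F : Pseudofunctor B C) {a b : B} (f : a ⟶ b) (c : B) :
    Bicategory.precomp c f ⋙ F.mapFunctor a c ⟶
      F.mapFunctor b c ⋙ Bicategory.precomp (F.obj c) (F.map f) where
  app g := (F.mapComp f g).hom
  naturality g g' θ := by
    change F.map₂ (Bicategory.whiskerLeft f θ) ≫ (F.mapComp f g').hom =
      (F.mapComp f g).hom ≫ Bicategory.whiskerLeft (F.map f) (F.map₂ θ)
    rw [F.map₂_whisker_left]
    simp

/-- The constraint `F (g ∘ f) ≅ F g ∘ F f` as a natural transformation in the variable `f`. -/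
@[simps]
def mapCompNatRight (F : Pseudofunctor B C) (a : B) {b c : B} (g : b ⟶ c) :
    Bicategory.postcomp a g ⋙ F.mapFunctor a c ⟶
      F.mapFunctor a b ⋙ Bicategory.postcomp (F.obj a) (F.map g) where
  app f := (F.mapComp f g).hom
  naturality f f' θ := by
    change F.map₂ (Bicategory.whiskerRight θ g) ≫ (F.mapComp f' g).hom =
      (F.mapComp f g).hom ≫ Bicategory.whiskerRight (F.map₂ θ) (F.map g)
    rw [F.map₂_whisker_right]
    simp

/-- The constraint `η_b ∘ F f ≅ G f ∘ η_a` of a strong transformation as a natural transformation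
in the variable `f : a ⟶ b`. -/
@[simps]
def naturalityNat {F G : Pseudofunctor B C} (η : F ⟶ G) (a b : B) :
    F.mapFunctor a b ⋙ Bicategory.postcomp (F.obj a) (η.app b) ⟶
      G.mapFunctor a b ⋙ Bicategory.precomp (G.obj b) (η.app a) where
  app f := (η.naturality f).hom
  naturality f f' θ := η.naturality_naturality θ

variable [SMCCategory B] [SMCCategory C]

variable (B C) in
/-- An SMC-functor: a pseudofunctor whose functors on categories of 1-cells are symmetric strong
monoidal and whose composition constraint is monoidal in each variable. -/
structure SMCFunctor where
  /-- The underlying pseudofunctor. -/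
  pseudofunctor : Pseudofunctor B C
  /-- The symmetric strong monoidal structures. -/
  [mapBraided : ∀ a b : B, (pseudofunctor.mapFunctor a b).Braided]
  /-- `F (- ∘ f) ≅ F - ∘ F f` is monoidal. -/
  mapCompNatLeft_isMonoidal : ∀ {a b : B} (f : a ⟶ b) (c : B),
    NatTrans.IsMonoidal (mapCompNatLeft pseudofunctor f c)
  /-- `F (g ∘ -) ≅ F g ∘ F -` is monoidal. -/
  mapCompNatRight_isMonoidal : ∀ (a : B) {b c : B} (g : b ⟶ c),
    NatTrans.IsMonoidal (mapCompNatRight pseudofunctor a g)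

attribute [instance] SMCFunctor.mapBraided

namespace SMCFunctor

/-- A strong monoidal transformation of SMC-functors: a strong transformation whose constraint
`η_b ∘ F f ≅ G f ∘ η_a` is monoidal in `f`. -/
structure Trans (F G : SMCFunctor B C) where
  /-- The underlying strong transformation. -/
  trans : F.pseudofunctor ⟶ G.pseudofunctor
  /-- The constraint is monoidal. -/
  isMonoidal : ∀ a b : B, NatTrans.IsMonoidal (naturalityNat trans a b)

/-- The category of strong monoidal transformations and modifications. -/
instance (F G : SMCFunctor B C) : Category (Trans F G) where
  Hom η θ := η.trans ⟶ θ.trans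
  id η := 𝟙 η.trans
  comp Γ Δ := Γ ≫ Δ

/-- The identity transformation is monoidal. -/
def idTrans (F : SMCFunctor B C) : Trans F F where
  trans := 𝟙 F.pseudofunctor
  isMonoidal a b := by
    have h₁ := SMCCategory.rightUnitor_isMonoidal (F.pseudofunctor.obj a) (F.pseudofunctor.obj b)
    have h₂ := SMCCategory.leftUnitor_isMonoidal (F.pseudofunctor.obj a) (F.pseudofunctor.obj b)
    have h₃ := isMonoidal_iso_inv _ h₂
    have h₄ := isMonoidal_comp _ _ h₁ h₃
    exact isMonoidal_congr (isMonoidal_whiskerLeft_functor (F.pseudofunctor.mapFunctor a b) _ h₄)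
      (fun f => rfl)

/-- The composite of monoidal transformations is monoidal. -/
def compTrans {F G H : SMCFunctor B C} (η : Trans F G) (θ : Trans G H) : Trans F H where
  trans := η.trans ≫ θ.trans
  isMonoidal a b := by
    have h₁ := isMonoidal_iso_inv _
      (SMCCategory.associatorLeft_isMonoidal (F.pseudofunctor.obj a) (η.trans.app b)
        (θ.trans.app b))
    have h₂ := isMonoidal_whiskerRight_functor _
      (Bicategory.postcomp (F.pseudofunctor.obj a) (θ.trans.app b)) (η.isMonoidal a b)
    have h₃ := SMCCategory.associatorMiddle_isMonoidal (η.trans.app a) (θ.trans.app b)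
    have h₄ := isMonoidal_whiskerRight_functor _
      (Bicategory.precomp (H.pseudofunctor.obj b) (η.trans.app a)) (θ.isMonoidal a b)
    have h₅ := isMonoidal_iso_inv _
      (SMCCategory.associatorRight_isMonoidal (η.trans.app a) (θ.trans.app a)
        (H.pseudofunctor.obj b))
    have h := isMonoidal_comp _ _
      (isMonoidal_whiskerLeft_functor (F.pseudofunctor.mapFunctor a b) _ h₁) <|
      isMonoidal_comp _ _ (isMonoidal_associator_functor_inv _ _ _) <|
      isMonoidal_comp _ _ h₂ <|
      isMonoidal_comp _ _ (isMonoidal_associator_functor_hom _ _ _) <|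
      isMonoidal_comp _ _
        (isMonoidal_whiskerLeft_functor (G.pseudofunctor.mapFunctor a b) _ h₃) <|
      isMonoidal_comp _ _ (isMonoidal_associator_functor_inv _ _ _) <|
      isMonoidal_comp _ _ h₄ <|
      isMonoidal_comp _ _ (isMonoidal_associator_functor_hom _ _ _) <|
      isMonoidal_whiskerLeft_functor (H.pseudofunctor.mapFunctor a b) _ h₅
    refine isMonoidal_congr h (fun f => ?_)
    change _ = ((η.trans ≫ θ.trans).naturality f).hom
    rw [Pseudofunctor.StrongTrans.categoryStruct_comp_naturality_hom]
    change (Bicategory.associator _ _ _).inv ≫ 𝟙 _ ≫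
      Bicategory.whiskerRight (η.trans.naturality f).hom (θ.trans.app b) ≫ 𝟙 _ ≫
      (Bicategory.associator _ _ _).hom ≫ 𝟙 _ ≫
      Bicategory.whiskerLeft (η.trans.app a) (θ.trans.naturality f).hom ≫ 𝟙 _ ≫
      (Bicategory.associator _ _ _).inv = _
    simp only [Category.id_comp]
    rfl

/-- The bicategory of SMC-functors, strong monoidal transformations and modifications. -/
instance : Bicategory (SMCFunctor B C) where
  Hom F G := Trans F G
  id F := idTrans F
  comp η θ := compTrans η θ
  whiskerLeft η _ _ Γ := Bicategory.whiskerLeft (Trans.trans η) Γ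
  whiskerRight Γ θ := Bicategory.whiskerRight (B := Pseudofunctor B C) Γ (Trans.trans θ)
  associator η θ ι :=
    { hom := (Bicategory.associator (Trans.trans η) (Trans.trans θ) (Trans.trans ι)).hom
      inv := (Bicategory.associator (Trans.trans η) (Trans.trans θ) (Trans.trans ι)).inv
      hom_inv_id := Iso.hom_inv_id
        (Bicategory.associator (Trans.trans η) (Trans.trans θ) (Trans.trans ι))
      inv_hom_id := Iso.inv_hom_id
        (Bicategory.associator (Trans.trans η) (Trans.trans θ) (Trans.trans ι)) }
  leftUnitor η :=
    { hom := (Bicategory.leftUnitor (Trans.trans η)).hom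
      inv := (Bicategory.leftUnitor (Trans.trans η)).inv
      hom_inv_id := Iso.hom_inv_id (Bicategory.leftUnitor (Trans.trans η))
      inv_hom_id := Iso.inv_hom_id (Bicategory.leftUnitor (Trans.trans η)) }
  rightUnitor η :=
    { hom := (Bicategory.rightUnitor (Trans.trans η)).hom
      inv := (Bicategory.rightUnitor (Trans.trans η)).inv
      hom_inv_id := Iso.hom_inv_id (Bicategory.rightUnitor (Trans.trans η))
      inv_hom_id := Iso.inv_hom_id (Bicategory.rightUnitor (Trans.trans η)) }
  whiskerLeft_id _ _ := Bicategory.whiskerLeft_id (B := Pseudofunctor B C) _ _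
  whiskerLeft_comp _ _ _ _ _ _ := Bicategory.whiskerLeft_comp (B := Pseudofunctor B C) _ _ _
  id_whiskerLeft _ := Bicategory.id_whiskerLeft (B := Pseudofunctor B C) _
  comp_whiskerLeft _ _ _ _ _ := Bicategory.comp_whiskerLeft (B := Pseudofunctor B C) _ _ _
  id_whiskerRight _ _ := Bicategory.id_whiskerRight (B := Pseudofunctor B C) _ _
  comp_whiskerRight _ _ _ := Bicategory.comp_whiskerRight (B := Pseudofunctor B C) _ _ _
  whiskerRight_id _ := Bicategory.whiskerRight_id (B := Pseudofunctor B C) _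
  whiskerRight_comp _ _ _ := Bicategory.whiskerRight_comp (B := Pseudofunctor B C) _ _ _
  whisker_assoc _ _ _ _ _ := Bicategory.whisker_assoc (B := Pseudofunctor B C) _ _ _
  whisker_exchange _ _ := Bicategory.whisker_exchange (B := Pseudofunctor B C) _ _
  pentagon _ _ _ _ := Bicategory.pentagon (B := Pseudofunctor B C) _ _ _ _
  triangle _ _ := Bicategory.triangle (B := Pseudofunctor B C) _ _

instance idMapBraided (a b : B) : ((Pseudofunctor.id B).mapFunctor a b).Braided :=
  (inferInstance : (𝟭 (a ⟶ b)).Braided)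

variable (B) in
/-- The identity SMC-functor. -/
def id : SMCFunctor B B where
  pseudofunctor := Pseudofunctor.id B
  mapCompNatLeft_isMonoidal {a b} f c := by
    have h := isMonoidal_comp _ _ (isMonoidal_rightUnitor_functor (Bicategory.precomp c f))
      (isMonoidal_leftUnitor_functor_inv (Bicategory.precomp c f))
    exact isMonoidal_congr h (fun g => Category.comp_id _)
  mapCompNatRight_isMonoidal a {b c} g := by
    have h := isMonoidal_comp _ _ (isMonoidal_rightUnitor_functor (Bicategory.postcomp a g))
      (isMonoidal_leftUnitor_functor_inv (Bicategory.postcomp a g))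
    exact isMonoidal_congr h (fun f => Category.comp_id _)

variable {D : Type u₃} [Bicategory.{w₃, v₃} D] [SMCCategory D]

instance compMapBraided (F : SMCFunctor B C) (G : SMCFunctor C D) (a b : B) :
    ((F.pseudofunctor.comp G.pseudofunctor).mapFunctor a b).Braided :=
  (inferInstance : (F.pseudofunctor.mapFunctor a b ⋙
    G.pseudofunctor.mapFunctor (F.pseudofunctor.obj a) (F.pseudofunctor.obj b)).Braided)

/-- The composite of SMC-functors, in diagrammatic order. -/
def comp (F : SMCFunctor B C) (G : SMCFunctor C D) : SMCFunctor B D where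
  pseudofunctor := F.pseudofunctor.comp G.pseudofunctor
  mapCompNatLeft_isMonoidal {a b} f c := by
    have h := isMonoidal_comp _ _ (isMonoidal_associator_functor_inv _ _ _) <|
      isMonoidal_comp _ _ (isMonoidal_whiskerRight_functor _ (G.pseudofunctor.mapFunctor _ _)
        (F.mapCompNatLeft_isMonoidal f c)) <|
      isMonoidal_comp _ _ (isMonoidal_associator_functor_hom _ _ _) <|
      isMonoidal_comp _ _ (isMonoidal_whiskerLeft_functor (F.pseudofunctor.mapFunctor _ _) _
        (G.mapCompNatLeft_isMonoidal (F.pseudofunctor.map f) (F.pseudofunctor.obj c))) <|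
      isMonoidal_associator_functor_inv _ _ _
    refine isMonoidal_congr h (fun g => ?_)
    change 𝟙 _ ≫ G.pseudofunctor.map₂ (F.pseudofunctor.mapComp f g).hom ≫ 𝟙 _ ≫
      (G.pseudofunctor.mapComp _ _).hom ≫ 𝟙 _ =
      G.pseudofunctor.map₂ (F.pseudofunctor.mapComp f g).hom ≫ (G.pseudofunctor.mapComp _ _).hom
    simp
  mapCompNatRight_isMonoidal a {b c} g := by
    have h := isMonoidal_comp _ _ (isMonoidal_associator_functor_inv _ _ _) <|
      isMonoidal_comp _ _ (isMonoidal_whiskerRight_functor _ (G.pseudofunctor.mapFunctor _ _)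
        (F.mapCompNatRight_isMonoidal a g)) <|
      isMonoidal_comp _ _ (isMonoidal_associator_functor_hom _ _ _) <|
      isMonoidal_comp _ _ (isMonoidal_whiskerLeft_functor (F.pseudofunctor.mapFunctor _ _) _
        (G.mapCompNatRight_isMonoidal (F.pseudofunctor.obj a) (F.pseudofunctor.map g))) <|
      isMonoidal_associator_functor_inv _ _ _
    refine isMonoidal_congr h (fun f => ?_)
    change 𝟙 _ ≫ G.pseudofunctor.map₂ (F.pseudofunctor.mapComp f g).hom ≫ 𝟙 _ ≫
      (G.pseudofunctor.mapComp _ _).hom ≫ 𝟙 _ =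
      G.pseudofunctor.map₂ (F.pseudofunctor.mapComp f g).hom ≫ (G.pseudofunctor.mapComp _ _).hom
    simp

/-- An SMC-functor `F : B ⟶ C` is a biequivalence if there are an SMC-functor `G : C ⟶ B` and
equivalences `F G ≃ 1` and `1 ≃ G F` (which may be taken to be adjoint equivalences, as every
equivalence in a bicategory can be improved to one) in the bicategories of SMC-functors, strong monoidal
transformations and modifications. -/
def IsBiequivalence (F : SMCFunctor B C) : Prop :=
  ∃ G : SMCFunctor C B,
    Nonempty (Bicategory.Equivalence (G.comp F) (SMCFunctor.id C)) ∧
      Nonempty (Bicategory.Equivalence (SMCFunctor.id B) (F.comp G))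

end SMCFunctor

end SMCFunctor

section Perm

/-- A permutative category is a symmetric monoidal category whose tensor product is strictly
associative and unital: the associativity and unit isomorphisms are identities. -/
structure IsPermutative (C : Type u) [Category.{v} C] [MonoidalCategory C] : Prop where
  tensor_assoc : ∀ X Y Z : C, (X ⊗ Y) ⊗ Z = X ⊗ (Y ⊗ Z)
  unit_tensor : ∀ X : C, 𝟙_ C ⊗ X = X
  tensor_unit : ∀ X : C, X ⊗ 𝟙_ C = X
  associator_eq : ∀ X Y Z : C, (α_ X Y Z).hom = eqToHom (tensor_assoc X Y Z)
  leftUnitor_eq : ∀ X : C, (λ_ X).hom = eqToHom (unit_tensor X)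
  rightUnitor_eq : ∀ X : C, (ρ_ X).hom = eqToHom (tensor_unit X)

/-- Permutative categories. -/
structure Perm where
  /-- The underlying symmetric monoidal category. -/
  toSymMon : SymMon.{v, u}
  /-- It is strictly associative and unital. -/
  isPermutative : IsPermutative toSymMon.carrier

/-- The 2-category of permutative categories, as a full sub-2-category of `SymMon`. -/
instance : Bicategory Perm.{v, u} where
  Hom P Q := P.toSymMon ⟶ Q.toSymMon
  id P := 𝟙 P.toSymMon
  comp F G := CategoryStruct.comp (obj := SymMon.{v, u}) F G
  whiskerLeft F _ _ α := Bicategory.whiskerLeft (B := SymMon.{v, u}) F α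
  whiskerRight α G := Bicategory.whiskerRight (B := SymMon.{v, u}) α G
  associator F G H := Bicategory.associator (B := SymMon.{v, u}) F G H
  leftUnitor F := Bicategory.leftUnitor (B := SymMon.{v, u}) F
  rightUnitor F := Bicategory.rightUnitor (B := SymMon.{v, u}) F
  whiskerLeft_id _ _ := Bicategory.whiskerLeft_id (B := SymMon.{v, u}) _ _
  whiskerLeft_comp _ _ _ _ _ _ := Bicategory.whiskerLeft_comp (B := SymMon.{v, u}) _ _ _
  id_whiskerLeft _ := Bicategory.id_whiskerLeft (B := SymMon.{v, u}) _
  comp_whiskerLeft _ _ _ _ _ := Bicategory.comp_whiskerLeft (B := SymMon.{v, u}) _ _ _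
  id_whiskerRight _ _ := Bicategory.id_whiskerRight (B := SymMon.{v, u}) _ _
  comp_whiskerRight _ _ _ := Bicategory.comp_whiskerRight (B := SymMon.{v, u}) _ _ _
  whiskerRight_id _ := Bicategory.whiskerRight_id (B := SymMon.{v, u}) _
  whiskerRight_comp _ _ _ := Bicategory.whiskerRight_comp (B := SymMon.{v, u}) _ _ _
  whisker_assoc _ _ _ _ _ := Bicategory.whisker_assoc (B := SymMon.{v, u}) _ _ _
  whisker_exchange _ _ := Bicategory.whisker_exchange (B := SymMon.{v, u}) _ _
  pentagon _ _ _ _ := Bicategory.pentagon (B := SymMon.{v, u}) _ _ _ _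
  triangle _ _ := Bicategory.triangle (B := SymMon.{v, u}) _ _

/-- Permutative categories form an SMC-category, with all the structure of `SymMon`. -/
instance : SMCCategory Perm.{v, u} where
  homMonoidal P Q := SMCCategory.homMonoidal P.toSymMon Q.toSymMon
  homSymmetric P Q := SMCCategory.homSymmetric P.toSymMon Q.toSymMon
  postcompBraided P _ _ G := SMCCategory.postcompBraided P.toSymMon G
  precompBraided F Q := SMCCategory.precompBraided (B := SymMon.{v, u}) F Q.toSymMon
  postcomposing_isMonoidal P _ _ _ _ η :=
    SMCCategory.postcomposing_isMonoidal (B := SymMon.{v, u}) P.toSymMon η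
  precomposing_isMonoidal η Q :=
    SMCCategory.precomposing_isMonoidal (B := SymMon.{v, u}) η Q.toSymMon
  sum_comp_sum F F' G G' := SMCCategory.sum_comp_sum (B := SymMon.{v, u}) F F' G G'
  zero_comp_sum P _ _ G G' := SMCCategory.zero_comp_sum (B := SymMon.{v, u}) P.toSymMon G G'
  sum_comp_zero F F' Q := SMCCategory.sum_comp_zero (B := SymMon.{v, u}) F F' Q.toSymMon
  zero_comp_zero P Q R := SMCCategory.zero_comp_zero P.toSymMon Q.toSymMon R.toSymMon
  associatorLeft_isMonoidal P _ _ _ G H :=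
    SMCCategory.associatorLeft_isMonoidal (B := SymMon.{v, u}) P.toSymMon G H
  associatorMiddle_isMonoidal F H :=
    SMCCategory.associatorMiddle_isMonoidal (B := SymMon.{v, u}) F H
  associatorRight_isMonoidal F G Q :=
    SMCCategory.associatorRight_isMonoidal (B := SymMon.{v, u}) F G Q.toSymMon
  leftUnitor_isMonoidal P Q := SMCCategory.leftUnitor_isMonoidal P.toSymMon Q.toSymMon
  rightUnitor_isMonoidal P Q := SMCCategory.rightUnitor_isMonoidal P.toSymMon Q.toSymMon

/-- The inclusion of permutative categories into symmetric monoidal categories, the identity on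
1-cells and 2-cells, as a pseudofunctor. -/
def Perm.inclusionPseudofunctor : Pseudofunctor Perm.{v, u} SymMon.{v, u} where
  obj P := P.toSymMon
  map F := F
  map₂ α := α
  mapId P := Iso.refl _
  mapComp F G := Iso.refl _
  map₂_whisker_left F _ _ α := ((Category.id_comp _).trans (Category.comp_id _)).symm
  map₂_whisker_right α F := ((Category.id_comp _).trans (Category.comp_id _)).symm
  map₂_associator {P Q R S} F G H := by
    change _ = 𝟙 _ ≫ Bicategory.whiskerRight (B := SymMon.{v, u}) (𝟙 _) H ≫
      (Bicategory.associator (B := SymMon.{v, u}) F G H).hom ≫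
      Bicategory.whiskerLeft (B := SymMon.{v, u}) F (𝟙 _) ≫ 𝟙 _
    rw [Bicategory.id_whiskerRight, Bicategory.whiskerLeft_id]
    simp only [Category.id_comp, Category.comp_id]
    rfl
  map₂_left_unitor {P Q} F := by
    change _ = 𝟙 _ ≫ Bicategory.whiskerRight (B := SymMon.{v, u}) (𝟙 _) F ≫
      (Bicategory.leftUnitor (B := SymMon.{v, u}) F).hom
    rw [Bicategory.id_whiskerRight]
    simp only [Category.id_comp]
    rfl
  map₂_right_unitor {P Q} F := by
    change _ = 𝟙 _ ≫ Bicategory.whiskerLeft (B := SymMon.{v, u}) F (𝟙 _) ≫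
      (Bicategory.rightUnitor (B := SymMon.{v, u}) F).hom
    rw [Bicategory.whiskerLeft_id]
    simp only [Category.id_comp]
    rfl

instance Perm.inclusionMapBraided (P Q : Perm.{v, u}) :
    (Perm.inclusionPseudofunctor.mapFunctor P Q).Braided :=
  (inferInstance : (𝟭 (P.toSymMon ⟶ Q.toSymMon)).Braided)

/-- The inclusion SMC-functor. -/
def Perm.inclusion : SMCFunctor Perm.{v, u} SymMon.{v, u} where
  pseudofunctor := Perm.inclusionPseudofunctor
  mapCompNatLeft_isMonoidal {P Q} F R := by
    have h := isMonoidal_comp _ _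
      (isMonoidal_rightUnitor_functor (Bicategory.precomp (B := SymMon.{v, u}) R.toSymMon F))
      (isMonoidal_leftUnitor_functor_inv (Bicategory.precomp (B := SymMon.{v, u}) R.toSymMon F))
    exact isMonoidal_congr h (fun G => Category.comp_id _)
  mapCompNatRight_isMonoidal P {Q R} G := by
    have h := isMonoidal_comp _ _
      (isMonoidal_rightUnitor_functor (Bicategory.postcomp (B := SymMon.{v, u}) P.toSymMon G))
      (isMonoidal_leftUnitor_functor_inv (Bicategory.postcomp (B := SymMon.{v, u}) P.toSymMon G))
    exact isMonoidal_congr h (fun F => Category.comp_id _)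

end Perm

end SMC

namespace SMC

open MonoidalCategory Functor.LaxMonoidal Functor.OplaxMonoidal Functor.Monoidal

/-! ### Strictification of a symmetric monoidal category by lists of objects. -/

section Strictification

variable {C : Type u} [Category.{v} C] [MonoidalCategory C]

/-! Every symmetric monoidal category `C` is equivalent to a permutative one, by Mac Lane's
strictification. The objects of the strict model are lists of objects of `C`, its morphisms are
those of `C` between right-bracketed sums, and its sum is concatenation. Evaluating a list is fully
faithful, and `X ↦ [X]` is an inverse up to isomorphism. The only coherence to check is that
associators and unitors transported along evaluation are the casts given by equalities of lists;
this is `listTensorAppend_associativity` and `listTensorAppend_nil`. Lists and induced morphisms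
stay in the same universes, so the model lies in `Perm.{v, u}`.

Choose for every `C` a permutative model with a symmetric monoidal adjoint equivalence `E_C` to `C`.
Since `Perm` is full in `SymMon`, conjugation `F ↦ E_D⁻¹ ∘ F ∘ E_C` lands in `Perm`. It is a
pseudofunctor by the unit, the counit and the triangle identities. It is an SMC-functor because it
is precomposition followed by postcomposition, both symmetric strong monoidal in an SMC-category,
and because the counit is a monoidal transformation.

The functors `E_C` and their inverses are the components of strong monoidal transformations between
conjugation and the identity, over `SymMon` and, by restriction, over `Perm`. Their constraints are
built from the counits. The units and counits of the `E_C` are the components of invertible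
modifications exhibiting these transformations as mutually inverse. Modifications carry no monoidal
condition, so this gives the two required equivalences.

The conjugation argument uses nothing about lists: it works for any choice of `PermutativeModel`. -/

/-- The right-bracketed sum of a list of objects. -/
def listTensor : List C → C
  | [] => 𝟙_ C
  | X :: l => X ⊗ listTensor l

/-- The canonical isomorphism between the sum of two right-bracketed sums and the right-bracketed
sum of the concatenation. -/
def listTensorAppend : ∀ l m : List C, listTensor l ⊗ listTensor m ≅ listTensor (l ++ m)
  | [], m => λ_ (listTensor m)
  | X :: l, m => α_ X (listTensor l) (listTensor m) ≪≫ whiskerLeftIso X (listTensorAppend l m)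

/-- In the inductions below, whiskering the hypothesis for `l` by `X` yields a whiskered cast; this
turns it into the cast for `X :: l`. -/
theorem whiskerLeft_eqToHom_listTensor (X : C) {l m : List C} (h : l = m) :
    X ◁ eqToHom (congrArg listTensor h) =
      eqToHom (congrArg (fun l => X ⊗ listTensor l) h) := by
  subst h
  exact MonoidalCategory.whiskerLeft_id _ _

/-- The inductive step of associativity, with lists replaced by arbitrary objects: whisker the
hypothesis by `X`, then use naturality of the associator and the pentagon. -/
theorem associativity_whiskerLeft (X : C) {K L M N P Q R : C} {f : K ⊗ L ⟶ N} {g : N ⊗ M ⟶ P}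
    {e : P ⟶ R} {h : L ⊗ M ⟶ Q} {k : K ⊗ Q ⟶ R}
    (w : f ▷ M ≫ g ≫ e = (α_ K L M).hom ≫ K ◁ h ≫ k) :
    ((α_ X K L).hom ≫ X ◁ f) ▷ M ≫ ((α_ X N M).hom ≫ X ◁ g) ≫ X ◁ e =
      (α_ (X ⊗ K) L M).hom ≫ (X ⊗ K) ◁ h ≫ (α_ X K Q).hom ≫ X ◁ k := by
  have h' := congrArg (X ◁ ·) w
  simp only [MonoidalCategory.whiskerLeft_comp] at h'
  simp [h']

/-- This makes the cast along `List.append_assoc` the associator transported from `C`. The induction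
is on `l`, the list on which `listTensorAppend` recurses. -/
theorem listTensorAppend_associativity (l m n : List C) :
    (listTensorAppend l m).hom ▷ listTensor n ≫ (listTensorAppend (l ++ m) n).hom ≫
        eqToHom (congrArg listTensor (List.append_assoc l m n)) =
      (α_ _ _ _).hom ≫ listTensor l ◁ (listTensorAppend m n).hom ≫
        (listTensorAppend l (m ++ n)).hom := by
  induction l with
  | nil =>
    -- For the empty list the cast is an identity and `listTensorAppend` is a left unitor, so
    -- naturality of `λ` and its compatibility with `α` suffice.
    have h : ∀ {L M N : C} (f : L ⊗ M ⟶ N), (λ_ L).hom ▷ M ≫ f ≫ 𝟙 _ =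
        (α_ (𝟙_ C) L M).hom ≫ 𝟙_ C ◁ f ≫ (λ_ _).hom := fun f => by simp
    exact h (listTensorAppend m n).hom
  | cons X l ih =>
    have h := associativity_whiskerLeft X ih
    rw [whiskerLeft_eqToHom_listTensor X (List.append_assoc l m n)] at h
    exact h

/-- The counterpart for the right unit. The base case is the coincidence of the two unitors at the
unit object; the step is the formula for the right unitor of `X ⊗ L`. -/
theorem listTensorAppend_nil (l : List C) :
    (listTensorAppend l []).hom ≫ eqToHom (congrArg listTensor (List.append_nil l)) =
      (ρ_ (listTensor l)).hom := by
  induction l with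
  | nil =>
    have h : (λ_ (𝟙_ C)).hom ≫ 𝟙 _ = (ρ_ (𝟙_ C)).hom := by simp [unitors_equal]
    exact h
  | cons X l ih =>
    have h : ∀ {L M : C} {f : L ⊗ 𝟙_ C ⟶ M} {e : M ⟶ L} (w : f ≫ e = (ρ_ L).hom),
        ((α_ X L (𝟙_ C)).hom ≫ X ◁ f) ≫ X ◁ e = (ρ_ (X ⊗ L)).hom := fun w => by
      rw [Category.assoc, ← MonoidalCategory.whiskerLeft_comp, w, rightUnitor_tensor_hom]
    have h' := h ih
    rw [whiskerLeft_eqToHom_listTensor X (List.append_nil l)] at h'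
    exact h'

variable (C) in
/-- The strictification: its objects are the lists of objects of `C`, and its morphisms are those
of `C` between the right-bracketed sums. -/
abbrev Strictification : Type u := InducedCategory C (listTensor (C := C))

namespace Strictification

variable (C) in
/-- The right-bracketed sum, as a functor. -/
abbrev eval : Strictification C ⥤ C := inducedFunctor listTensor

/-- Morphisms are conjugated by `listTensorAppend`, so that it becomes the structure isomorphism of
`eval`. The constraints are instead prescribed as casts, which makes strictness immediate and moves
the work into comparing them with those of `C`. -/
instance : MonoidalCategoryStruct (Strictification C) where
  tensorObj (l m : List C) := (l ++ m : List C)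
  tensorUnit := ([] : List C)
  whiskerLeft l m m' f := InducedCategory.homMk <|
    (listTensorAppend l m).inv ≫ listTensor l ◁ f.hom ≫ (listTensorAppend l m').hom
  whiskerRight {l l'} f m := InducedCategory.homMk <|
    (listTensorAppend l m).inv ≫ f.hom ▷ listTensor m ≫ (listTensorAppend l' m).hom
  tensorHom {l l' m m'} f g := InducedCategory.homMk <|
    (listTensorAppend l m).inv ≫ (f.hom ⊗ₘ g.hom) ≫ (listTensorAppend l' m').hom
  associator l m n := eqToIso (List.append_assoc l m n)
  -- `[] ++ l` is `l` by computation, whereas `l ++ []` equals `l` only by induction, hence the cast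
  -- in the next field.
  leftUnitor l := Iso.refl l
  rightUnitor l := eqToIso (List.append_nil l)

theorem eval_map_eqToHom {l m : Strictification C} (h : l = m) :
    (eval C).map (eqToHom h) = eqToHom (congrArg listTensor h) := by
  subst h
  rfl

variable (C) in
/-- The comparison of the structures of the strictification and of `C`. -/
def evalData : Monoidal.InducingFunctorData (eval C) where
  μIso l m := listTensorAppend l m
  εIso := Iso.refl (𝟙_ C)
  whiskerLeft_eq _ _ _ _ := rfl
  whiskerRight_eq _ _ := rfl
  tensorHom_eq _ _ := rfl
  associator_eq l m n := by
    -- This solves the associativity square for the cast `e`, in the form that the inducing data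
    -- require.
    have h : ∀ {K L M N P Q R : C} {f : K ⊗ L ≅ N} {g : N ⊗ M ≅ P} {e : P ⟶ R} {h : L ⊗ M ≅ Q}
        {k : K ⊗ Q ≅ R} (w : f.hom ▷ M ≫ g.hom ≫ e = (α_ K L M).hom ≫ K ◁ h.hom ≫ k.hom),
        e = ((g.symm ≪≫ (f.symm ⊗ᵢ .refl _)) ≪≫ α_ K L M ≪≫ ((.refl _ ⊗ᵢ h) ≪≫ k)).hom :=
      fun {_ _ _ _ _ _ _ f g _ _ _} w => by simp [← w]
    exact (eval_map_eqToHom (List.append_assoc l m n)).trans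
      (h (listTensorAppend_associativity l m n))
  leftUnitor_eq l := by
    have h : ∀ X : C, 𝟙 X =
        (((λ_ X).symm ≪≫ ((Iso.refl _).symm ⊗ᵢ .refl _)) ≪≫ λ_ X).hom := fun X => by simp
    exact h (listTensor l)
  rightUnitor_eq l := by
    have h : ∀ {L M : C} {f : L ⊗ 𝟙_ C ≅ M} {e : M ⟶ L} (w : f.hom ≫ e = (ρ_ L).hom),
        e = ((f.symm ≪≫ (.refl _ ⊗ᵢ (Iso.refl _).symm)) ≪≫ ρ_ L).hom := fun {_ _ f _} w => by
      rw [← cancel_epi f.hom, w]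
      simp
    exact (eval_map_eqToHom (List.append_nil l)).trans (h (listTensorAppend_nil l))

instance : MonoidalCategory (Strictification C) :=
  Monoidal.induced (eval C) (evalData C)

instance : (eval C).Monoidal :=
  Monoidal.fromInducedMonoidal (eval C) (evalData C)

theorem isPermutative : IsPermutative (Strictification C) where
  tensor_assoc := List.append_assoc
  unit_tensor := List.nil_append
  tensor_unit := List.append_nil
  associator_eq _ _ _ := rfl
  leftUnitor_eq _ := rfl
  rightUnitor_eq _ := rfl

variable (C) in
/-- The equivalence between the strictification and `C`. -/
def equivalence : Strictification C ≌ C where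
  functor := eval C
  inverse :=
    -- The sum of `[X]` is `X ⊗ 𝟙_ C` rather than `X`. This is why morphisms are whiskered by the
    -- unit, and why unit and counit are right unitors; the triangle identity is then `ρ⁻¹ ≫ ρ = 𝟙`.
    { obj X := ([X] : List C)
      map f := InducedCategory.homMk (f ▷ 𝟙_ C)
      map_id X := InducedCategory.hom_ext (id_whiskerRight X (𝟙_ C))
      map_comp f g := InducedCategory.hom_ext (comp_whiskerRight f g (𝟙_ C)) }
  unitIso := NatIso.ofComponents (fun l => InducedCategory.isoMk (ρ_ (listTensor l)).symm)
    (fun f => InducedCategory.hom_ext (rightUnitor_inv_naturality f.hom))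
  counitIso := NatIso.ofComponents (fun X => ρ_ X) (fun f => rightUnitor_naturality f)
  functor_unitIso_comp l := Iso.inv_hom_id (ρ_ (listTensor l))

instance : (equivalence C).functor.Monoidal := inferInstanceAs (eval C).Monoidal

/-- Doctrinal adjunction: the inverse receives the mate of the structure on `eval`, the one for
which unit and counit are monoidal. -/
noncomputable instance : (equivalence C).inverse.Monoidal := (equivalence C).inverseMonoidal

instance : (equivalence C).IsMonoidal :=
  letI := (equivalence C).toAdjunction.rightAdjointLaxMonoidal
  inferInstanceAs (equivalence C).toAdjunction.IsMonoidal

section Symmetric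

variable [SymmetricCategory C]

/-- The symmetry is the one of `C` between the evaluated lists; its axioms are reflected by the
faithful functor `eval`. -/
instance : BraidedCategory (Strictification C) :=
  .ofFaithful (eval C)
    (fun l m => InducedCategory.isoMk <|
      (listTensorAppend l m).symm ≪≫ β_ (listTensor l) (listTensor m) ≪≫ listTensorAppend m l)
    (fun l m => Iso.hom_inv_id_assoc (listTensorAppend l m) _)

instance : (eval C).Braided where
  braided l m := Iso.hom_inv_id_assoc (listTensorAppend l m) _

instance : SymmetricCategory (Strictification C) := .ofFaithful (eval C)

instance : (equivalence C).functor.Braided := inferInstanceAs (eval C).Braided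

noncomputable instance : (equivalence C).inverse.Braided where
  braided X Y := by
    -- The structure morphisms of the inverse are known only through their image under the functor
    -- followed by the counit. Both operations lose nothing, and afterwards the equation reduces to
    -- naturality of the counit and the symmetry of the functor.
    apply (equivalence C).functor.map_injective
    rw [← cancel_mono ((equivalence C).counit.app (Y ⊗ X))]
    have h₁ := (equivalence C).functor_map_μ_inverse_comp_counit_app_tensor X Y
    have h₂ := (equivalence C).functor_map_μ_inverse_comp_counit_app_tensor Y X
    have h₃ := (equivalence C).counit.naturality (β_ X Y).hom
    dsimp only [Functor.comp_map, Functor.id_map] at h₃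
    rw [Functor.map_comp, Category.assoc, h₃, reassoc_of% h₁, Functor.map_comp, Category.assoc, h₂,
      Functor.map_braiding]
    simp

end Symmetric

end Strictification

end Strictification

/-! ### Permutative models and identities for monoidal adjoint equivalences. -/

/-- A permutative category together with a symmetric monoidal adjoint equivalence to `C`. -/
structure PermutativeModel (C : SymMon.{v, u}) where
  /-- The permutative category. -/
  perm : Perm.{v, u}
  /-- The equivalence. -/
  equivalence : perm.toSymMon.carrier ≌ C.carrier
  /-- The symmetric strong monoidal structure on the functor. -/
  [functorBraided : equivalence.functor.Braided]
  /-- The symmetric strong monoidal structure on the inverse. -/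
  [inverseBraided : equivalence.inverse.Braided]
  /-- The unit and the counit are monoidal. -/
  [isMonoidal : equivalence.IsMonoidal]

attribute [instance] PermutativeModel.functorBraided PermutativeModel.inverseBraided
  PermutativeModel.isMonoidal

/-- The strictification is a permutative model. -/
noncomputable def strictificationModel (C : SymMon.{v, u}) : PermutativeModel C where
  perm := ⟨⟨Strictification C.carrier⟩, Strictification.isPermutative⟩
  equivalence := Strictification.equivalence C.carrier
  functorBraided := inferInstanceAs (Strictification.equivalence C.carrier).functor.Braided
  inverseBraided := inferInstanceAs (Strictification.equivalence C.carrier).inverse.Braided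
  isMonoidal := inferInstanceAs (Strictification.equivalence C.carrier).IsMonoidal

section

variable {P : Type u₁} [Category.{v₁} P] {C : Type u₂} [Category.{v₂} C] (e : P ≌ C)
  [MonoidalCategory P] [MonoidalCategory C] [e.functor.Monoidal] [e.inverse.Monoidal]
  [e.IsMonoidal]

/-- Monoidality of the unit at the unit object, rearranged for the inverse of the unit. With the
binary version that follows, it makes `conjId` monoidal. -/
theorem ε_inverse_comp_map_ε_functor_comp_unitInv :
    ε e.inverse ≫ e.inverse.map (ε e.functor) ≫ e.unitIso.inv.app (𝟙_ P) = 𝟙 _ := by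
  have h := NatTrans.IsMonoidal.unit (τ := e.unitIso.hom)
  change 𝟙 _ ≫ e.unitIso.hom.app (𝟙_ P) = ε e.inverse ≫ e.inverse.map (ε e.functor) at h
  rw [← Category.assoc, ← h]
  simp

theorem μ_inverse_comp_map_μ_functor_comp_unitInv (X Y : P) :
    μ e.inverse (e.functor.obj X) (e.functor.obj Y) ≫ e.inverse.map (μ e.functor X Y) ≫
        e.unitIso.inv.app (X ⊗ Y) =
      (e.unitIso.inv.app X ⊗ₘ e.unitIso.inv.app Y) := by
  have h := NatTrans.IsMonoidal.tensor (τ := e.unitIso.hom) X Y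
  change 𝟙 _ ≫ e.unitIso.hom.app (X ⊗ Y) = (e.unitIso.hom.app X ⊗ₘ e.unitIso.hom.app Y) ≫
    μ e.inverse _ _ ≫ e.inverse.map (μ e.functor X Y) at h
  rw [Category.id_comp] at h
  rw [← cancel_epi (e.unitIso.hom.app X ⊗ₘ e.unitIso.hom.app Y), ← Category.assoc (μ _ _ _),
    ← Category.assoc, ← h]
  simp

theorem ε_functor_comp_map_ε_inverse_comp_counit :
    ε e.functor ≫ e.functor.map (ε e.inverse) ≫ e.counitIso.hom.app (𝟙_ C) = 𝟙 _ := by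
  have h := NatTrans.IsMonoidal.unit (τ := e.counit)
  change (ε e.functor ≫ e.functor.map (ε e.inverse)) ≫ e.counitIso.hom.app (𝟙_ C) = 𝟙 _ at h
  rwa [Category.assoc] at h

theorem μ_functor_comp_map_μ_inverse_comp_counit (X Y : C) :
    μ e.functor (e.inverse.obj X) (e.inverse.obj Y) ≫ e.functor.map (μ e.inverse X Y) ≫
        e.counitIso.hom.app (X ⊗ Y) =
      (e.counitIso.hom.app X ⊗ₘ e.counitIso.hom.app Y) := by
  have h := NatTrans.IsMonoidal.tensor (τ := e.counit) X Y
  change (μ e.functor _ _ ≫ e.functor.map (μ e.inverse X Y)) ≫ e.counitIso.hom.app (X ⊗ Y) =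
    (e.counitIso.hom.app X ⊗ₘ e.counitIso.hom.app Y) ≫ 𝟙 _ at h
  rwa [Category.assoc, Category.comp_id] at h

/-- Monoidality of the counit, solved for the structure morphism of the composite `inverse ⋙
functor`. -/
theorem ε_functor_comp_map_ε_inverse :
    ε e.functor ≫ e.functor.map (ε e.inverse) = e.counitIso.inv.app (𝟙_ C) := by
  rw [← cancel_mono (e.counitIso.hom.app (𝟙_ C)), Category.assoc,
    ε_functor_comp_map_ε_inverse_comp_counit]
  simp

theorem μ_functor_comp_map_μ_inverse (X Y : C) :
    μ e.functor (e.inverse.obj X) (e.inverse.obj Y) ≫ e.functor.map (μ e.inverse X Y) =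
      (e.counitIso.hom.app X ⊗ₘ e.counitIso.hom.app Y) ≫ e.counitIso.inv.app (X ⊗ Y) := by
  rw [← cancel_mono (e.counitIso.hom.app (X ⊗ Y)), Category.assoc,
    μ_functor_comp_map_μ_inverse_comp_counit]
  simp

/-- When `inverse` is followed by `functor` inside a composite of conjugates, structure maps appear
in this pattern. Naturality of the inverse counit carries `f` out of both functors, leaving a single
counit component to cancel. -/
theorem ε_functor_comp_map_inverse {X : C} (f : 𝟙_ C ⟶ X) :
    ε e.functor ≫ e.functor.map (ε e.inverse ≫ e.inverse.map f) =
      f ≫ e.counitIso.inv.app X := by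
  rw [Functor.map_comp, ← Category.assoc, ε_functor_comp_map_ε_inverse]
  simp

theorem μ_functor_comp_map_inverse {X Y Z : C} (f : X ⊗ Y ⟶ Z) :
    μ e.functor (e.inverse.obj X) (e.inverse.obj Y) ≫
        e.functor.map (μ e.inverse X Y ≫ e.inverse.map f) =
      (e.counitIso.hom.app X ⊗ₘ e.counitIso.hom.app Y) ≫ f ≫ e.counitIso.inv.app Z := by
  rw [Functor.map_comp, ← Category.assoc, μ_functor_comp_map_μ_inverse]
  simp

end

/-! ### Conjugation by the chosen equivalences as an SMC-functor. -/

namespace PermutativeModel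

open SymMonFunctor

variable {C : SymMon.{v, u}} (M : PermutativeModel C)

/-- The equivalence as a symmetric monoidal functor. -/
def hom : SymMonFunctor M.perm.toSymMon.carrier C.carrier :=
  ⟨M.equivalence.functor⟩

/-- The inverse equivalence as a symmetric monoidal functor. -/
def inv : SymMonFunctor C.carrier M.perm.toSymMon.carrier :=
  ⟨M.equivalence.inverse⟩

/-- The unit of the equivalence as a monoidal transformation. -/
def unit : idFunctor M.perm.toSymMon.carrier ≅ M.hom.compFunctor M.inv :=
  isoMk M.equivalence.unitIso (inferInstanceAs (NatTrans.IsMonoidal M.equivalence.unit))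

/-- The counit of the equivalence as a monoidal transformation. -/
def counit : M.inv.compFunctor M.hom ≅ idFunctor C.carrier :=
  isoMk M.equivalence.counitIso (inferInstanceAs (NatTrans.IsMonoidal M.equivalence.counit))

variable (S : ∀ C : SymMon.{v, u}, PermutativeModel C)

/-- Conjugation by the chosen equivalences. -/
def conj {C D : SymMon.{v, u}} (F : SymMonFunctor C.carrier D.carrier) :
    SymMonFunctor (S C).perm.toSymMon.carrier (S D).perm.toSymMon.carrier :=
  ((S C).hom.compFunctor F).compFunctor (S D).inv

/-- Conjugation preserves identities, by the unit of the equivalence. -/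
def conjId (C : SymMon.{v, u}) :
    conj S (idFunctor C.carrier) ≅ idFunctor (S C).perm.toSymMon.carrier :=
  isoMk (NatIso.ofComponents
      (F := (conj S (idFunctor C.carrier)).functor) (G := 𝟭 _)
      (fun X => ((S C).equivalence.unitIso.app X).symm)
      (fun f => (S C).equivalence.unitInv.naturality f))
    { unit := by
        change (ε (S C).equivalence.inverse ≫ (S C).equivalence.inverse.map (𝟙 _ ≫
          ε (S C).equivalence.functor)) ≫ (S C).equivalence.unitIso.inv.app _ = 𝟙 _
        rw [Category.id_comp, Category.assoc, ε_inverse_comp_map_ε_functor_comp_unitInv]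
      tensor X Y := by
        change (μ (S C).equivalence.inverse _ _ ≫ (S C).equivalence.inverse.map (𝟙 _ ≫
          μ (S C).equivalence.functor X Y)) ≫ (S C).equivalence.unitIso.inv.app _ =
            ((S C).equivalence.unitIso.inv.app X ⊗ₘ (S C).equivalence.unitIso.inv.app Y) ≫ 𝟙 _
        rw [Category.id_comp, Category.assoc, μ_inverse_comp_map_μ_functor_comp_unitInv,
          Category.comp_id] }

/-- Conjugation preserves composition, by the counit of the equivalence. -/
def conjComp {A B C : SymMon.{v, u}} (F : SymMonFunctor A.carrier B.carrier)
    (G : SymMonFunctor B.carrier C.carrier) :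
    conj S (F.compFunctor G) ≅ (conj S F).compFunctor (conj S G) :=
  isoMk (NatIso.ofComponents
      (F := (conj S (F.compFunctor G)).functor) (G := ((conj S F).compFunctor (conj S G)).functor)
      -- The composite of the conjugates contains the round trip through the model of `B` between
      -- `F` and `G`; the inverse counit inserts it.
      (fun X => (G.functor ⋙ (S C).equivalence.inverse).mapIso
        ((S B).equivalence.counitIso.app
          (F.functor.obj ((S A).equivalence.functor.obj X))).symm)
      (fun {X Y} f => by
        have h := (S B).equivalence.counitInv.naturality
          (F.functor.map ((S A).equivalence.functor.map f))
        exact ((G.functor ⋙ (S C).equivalence.inverse).map_comp _ _).symm.trans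
          ((congrArg (G.functor ⋙ (S C).equivalence.inverse).map h).trans
            ((G.functor ⋙ (S C).equivalence.inverse).map_comp _ _))))
    { unit := by
        change (ε (S C).equivalence.inverse ≫ (S C).equivalence.inverse.map
            ((ε G.functor ≫ G.functor.map (ε F.functor)) ≫
              G.functor.map (F.functor.map (ε (S A).equivalence.functor)))) ≫
            (S C).equivalence.inverse.map (G.functor.map
              ((S B).equivalence.counitIso.inv.app _)) =
          (ε (S C).equivalence.inverse ≫ (S C).equivalence.inverse.map
            (ε G.functor ≫ G.functor.map (ε (S B).equivalence.functor))) ≫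
            (S C).equivalence.inverse.map (G.functor.map ((S B).equivalence.functor.map
              (ε (S B).equivalence.inverse ≫ (S B).equivalence.inverse.map
                (ε F.functor ≫ F.functor.map (ε (S A).equivalence.functor)))))
        simp only [Category.assoc, ← Functor.map_comp, ε_functor_comp_map_inverse]
      tensor X Y := by
        change (μ (S C).equivalence.inverse _ _ ≫ (S C).equivalence.inverse.map
            ((μ G.functor _ _ ≫ G.functor.map (μ F.functor _ _)) ≫
              G.functor.map (F.functor.map (μ (S A).equivalence.functor X Y)))) ≫
            (S C).equivalence.inverse.map (G.functor.map
              ((S B).equivalence.counitIso.inv.app _)) =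
          ((S C).equivalence.inverse.map (G.functor.map
              ((S B).equivalence.counitIso.inv.app _)) ⊗ₘ
            (S C).equivalence.inverse.map (G.functor.map
              ((S B).equivalence.counitIso.inv.app _))) ≫
          (μ (S C).equivalence.inverse _ _ ≫ (S C).equivalence.inverse.map
            (μ G.functor _ _ ≫ G.functor.map (μ (S B).equivalence.functor _ _))) ≫
            (S C).equivalence.inverse.map (G.functor.map ((S B).equivalence.functor.map
              (μ (S B).equivalence.inverse _ _ ≫ (S B).equivalence.inverse.map
                (μ F.functor _ _ ≫ F.functor.map (μ (S A).equivalence.functor X Y)))))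
        simp only [Category.assoc, ← Functor.map_comp, μ_functor_comp_map_inverse,
          μ_natural_assoc]
        -- Naturality of the structure morphisms brings the tensored counit components next to the
        -- tensored inverse components, where they cancel.
        simp only [Functor.map_comp, ← μ_natural_assoc]
        simp [← Functor.map_comp] }

/-- Conjugation by the chosen equivalences, as a pseudofunctor. -/
def conjPseudofunctor : Pseudofunctor SymMon.{v, u} Perm.{v, u} where
  obj C := (S C).perm
  map F := conj S F
  map₂ {C D F G} α := whiskerRightHom (whiskerLeftHom (S C).hom α) (S D).inv
  map₂_id {C D} F := Hom.ext <| NatTrans.ext <| funext fun X =>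
    (S D).equivalence.inverse.map_id _
  map₂_comp {C D _ _ _} α β := Hom.ext <| NatTrans.ext <| funext fun X =>
    (S D).equivalence.inverse.map_comp _ _
  mapId C := conjId S C
  mapComp F G := conjComp S F G
  map₂_whisker_left {A B C} F G G' α := Hom.ext <| NatTrans.ext <| funext fun X => by
    change (S C).equivalence.inverse.map ((Hom.nat α).app _) =
      (S C).equivalence.inverse.map (G.functor.map ((S B).equivalence.counitIso.inv.app _)) ≫
      (S C).equivalence.inverse.map ((Hom.nat α).app _) ≫
      (S C).equivalence.inverse.map (G'.functor.map ((S B).equivalence.counitIso.hom.app _))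
    simp [← Functor.map_comp]
  map₂_whisker_right {A B C F F'} α G := Hom.ext <| NatTrans.ext <| funext fun X => by
    change (S C).equivalence.inverse.map (G.functor.map ((Hom.nat α).app _)) =
      (S C).equivalence.inverse.map (G.functor.map ((S B).equivalence.counitIso.inv.app _)) ≫
      (S C).equivalence.inverse.map (G.functor.map ((S B).equivalence.functor.map
        ((S B).equivalence.inverse.map ((Hom.nat α).app _)))) ≫
      (S C).equivalence.inverse.map (G.functor.map ((S B).equivalence.counitIso.hom.app _))
    simp [← Functor.map_comp]
  -- The counits at `B` and `C` can be inserted in either order by naturality of the counit at `C`.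
  map₂_associator {A B C D} F G H := Hom.ext <| NatTrans.ext <| funext fun X => by
    change (S D).equivalence.inverse.map (𝟙 _) =
      (S D).equivalence.inverse.map (H.functor.map ((S C).equivalence.counitIso.inv.app _)) ≫
      (S D).equivalence.inverse.map (H.functor.map ((S C).equivalence.functor.map
        ((S C).equivalence.inverse.map (G.functor.map
          ((S B).equivalence.counitIso.inv.app _))))) ≫ 𝟙 _ ≫
      (S D).equivalence.inverse.map (H.functor.map ((S C).equivalence.counitIso.hom.app _)) ≫
      (S D).equivalence.inverse.map (H.functor.map (G.functor.map
          ((S B).equivalence.counitIso.hom.app _)))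
    simp [← Functor.map_comp]
  -- The two unit axioms are the two triangle identities: here the one in the image of the functor
  -- at `A`, below the one in the image of the inverse at `B`.
  map₂_left_unitor {A B} F := Hom.ext <| NatTrans.ext <| funext fun X => by
    change (S B).equivalence.inverse.map (𝟙 _) =
      (S B).equivalence.inverse.map (F.functor.map ((S A).equivalence.counitIso.inv.app _)) ≫
      (S B).equivalence.inverse.map (F.functor.map ((S A).equivalence.functor.map
        ((S A).equivalence.unitIso.inv.app X))) ≫ 𝟙 _
    simp [← Functor.map_comp]
  map₂_right_unitor {A B} F := Hom.ext <| NatTrans.ext <| funext fun X => by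
    change (S B).equivalence.inverse.map (𝟙 _) =
      (S B).equivalence.inverse.map ((S B).equivalence.counitIso.inv.app _) ≫
      (S B).equivalence.unitIso.inv.app _ ≫ 𝟙 _
    simp

/-- Bilinearity of composition supplies the structure: on 1-cells, conjugation is precomposition
with `(S C).hom` followed by postcomposition with `(S D).inv`. -/
instance conjMapBraided (C D : SymMon.{v, u}) :
    ((conjPseudofunctor S).mapFunctor C D).Braided :=
  inferInstanceAs (Bicategory.precomp (B := SymMon.{v, u}) (a := (S C).perm.toSymMon) D (S C).hom ⋙
    Bicategory.postcomp (B := SymMon.{v, u}) (c := (S D).perm.toSymMon)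
      (S C).perm.toSymMon (S D).inv).Braided

/-- Conjugation by the chosen equivalences, as an SMC-functor. -/
def conjSMCFunctor : SMCFunctor SymMon.{v, u} Perm.{v, u} where
  pseudofunctor := conjPseudofunctor S
  -- Precomposition has identity structure maps, so in the variable `G` only those of the inverse at
  -- `C` remain, and their naturality suffices.
  mapCompNatLeft_isMonoidal {A B} F C :=
    { unit := Hom.ext <| NatTrans.ext <| funext fun X => by
        change ((ε (S C).equivalence.inverse ≫ (S C).equivalence.inverse.map (𝟙 _)) ≫
            (S C).equivalence.inverse.map (𝟙 _)) ≫ (S C).equivalence.inverse.map (𝟙 _) =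
          𝟙 _ ≫ (ε (S C).equivalence.inverse ≫ (S C).equivalence.inverse.map (𝟙 _))
        simp
      tensor G G' := Hom.ext <| NatTrans.ext <| funext fun X => by
        change ((μ (S C).equivalence.inverse _ _ ≫ (S C).equivalence.inverse.map (𝟙 _)) ≫
            (S C).equivalence.inverse.map (𝟙 _)) ≫ (S C).equivalence.inverse.map
              (G.functor.map ((S B).equivalence.counitIso.inv.app _) ⊗ₘ
                G'.functor.map ((S B).equivalence.counitIso.inv.app _)) =
          ((S C).equivalence.inverse.map
              (G.functor.map ((S B).equivalence.counitIso.inv.app _)) ⊗ₘ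
            (S C).equivalence.inverse.map
              (G'.functor.map ((S B).equivalence.counitIso.inv.app _))) ≫
            𝟙 _ ≫ (μ (S C).equivalence.inverse _ _ ≫ (S C).equivalence.inverse.map (𝟙 _))
        simp }
  -- In the variable `F` the structure maps of `G` and of the equivalence at `B` also enter;
  -- monoidality of the counit at `B` removes the latter, as in `conjComp`.
  mapCompNatRight_isMonoidal A {B C} G :=
    { unit := Hom.ext <| NatTrans.ext <| funext fun X => by
        change ((ε (S C).equivalence.inverse ≫ (S C).equivalence.inverse.map (𝟙 _)) ≫
            (S C).equivalence.inverse.map (ε G.functor)) ≫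
            (S C).equivalence.inverse.map (G.functor.map
              ((S B).equivalence.counitIso.inv.app _)) =
          (ε (S C).equivalence.inverse ≫ (S C).equivalence.inverse.map
            (ε G.functor ≫ G.functor.map (ε (S B).equivalence.functor))) ≫
            (S C).equivalence.inverse.map (G.functor.map ((S B).equivalence.functor.map
              (ε (S B).equivalence.inverse ≫ (S B).equivalence.inverse.map (𝟙 _))))
        simp only [Category.assoc, ← Functor.map_comp, ε_functor_comp_map_inverse,
          Category.id_comp]
      tensor F F' := Hom.ext <| NatTrans.ext <| funext fun X => by
        change ((μ (S C).equivalence.inverse _ _ ≫ (S C).equivalence.inverse.map (𝟙 _)) ≫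
            (S C).equivalence.inverse.map (μ G.functor _ _)) ≫
            (S C).equivalence.inverse.map (G.functor.map
              ((S B).equivalence.counitIso.inv.app _)) =
          ((S C).equivalence.inverse.map (G.functor.map
              ((S B).equivalence.counitIso.inv.app _)) ⊗ₘ
            (S C).equivalence.inverse.map (G.functor.map
              ((S B).equivalence.counitIso.inv.app _))) ≫
          (μ (S C).equivalence.inverse _ _ ≫ (S C).equivalence.inverse.map
            (μ G.functor _ _ ≫ G.functor.map (μ (S B).equivalence.functor _ _))) ≫
            (S C).equivalence.inverse.map (G.functor.map ((S B).equivalence.functor.map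
              (μ (S B).equivalence.inverse _ _ ≫ (S B).equivalence.inverse.map (𝟙 _))))
        simp only [Category.assoc, ← Functor.map_comp, μ_functor_comp_map_inverse,
          μ_natural_assoc, Category.id_comp]
        simp only [Functor.map_comp, ← μ_natural_assoc]
        simp [← Functor.map_comp] }

variable {S} in
/-- The equivalences intertwine conjugation with the identity. -/
def conjHomIso {C D : SymMon.{v, u}} (F : SymMonFunctor C.carrier D.carrier) :
    (conj S F).compFunctor (S D).hom ≅ (S C).hom.compFunctor F :=
  isoMk (NatIso.ofComponents
      (F := ((conj S F).compFunctor (S D).hom).functor) (G := ((S C).hom.compFunctor F).functor)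
      (fun X => (S D).equivalence.counitIso.app
        (F.functor.obj ((S C).equivalence.functor.obj X)))
      (fun f => (S D).equivalence.counit.naturality _))
    { unit := by
        change (ε (S D).equivalence.functor ≫ (S D).equivalence.functor.map
            (ε (S D).equivalence.inverse ≫ (S D).equivalence.inverse.map
              (ε F.functor ≫ F.functor.map (ε (S C).equivalence.functor)))) ≫
            (S D).equivalence.counitIso.hom.app _ =
          ε F.functor ≫ F.functor.map (ε (S C).equivalence.functor)
        rw [ε_functor_comp_map_inverse]
        simp
      tensor X Y := by
        change (μ (S D).equivalence.functor _ _ ≫ (S D).equivalence.functor.map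
            (μ (S D).equivalence.inverse _ _ ≫ (S D).equivalence.inverse.map
              (μ F.functor _ _ ≫ F.functor.map (μ (S C).equivalence.functor X Y)))) ≫
            (S D).equivalence.counitIso.hom.app _ =
          ((S D).equivalence.counitIso.hom.app _ ⊗ₘ (S D).equivalence.counitIso.hom.app _) ≫
            μ F.functor _ _ ≫ F.functor.map (μ (S C).equivalence.functor X Y)
        rw [μ_functor_comp_map_inverse]
        simp }

variable {S} in
/-- The inverse equivalences intertwine the identity with conjugation. -/
def invConjIso {C D : SymMon.{v, u}} (F : SymMonFunctor C.carrier D.carrier) :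
    F.compFunctor (S D).inv ≅ (S C).inv.compFunctor (conj S F) :=
  isoMk (NatIso.ofComponents
      (F := (F.compFunctor (S D).inv).functor) (G := ((S C).inv.compFunctor (conj S F)).functor)
      (fun X => (F.functor ⋙ (S D).equivalence.inverse).mapIso
        ((S C).equivalence.counitIso.app X).symm)
      (fun {X Y} f => by
        have h := (S C).equivalence.counitInv.naturality f
        exact ((F.functor ⋙ (S D).equivalence.inverse).map_comp _ _).symm.trans
          ((congrArg (F.functor ⋙ (S D).equivalence.inverse).map h).trans
            ((F.functor ⋙ (S D).equivalence.inverse).map_comp _ _))))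
    { unit := by
        change (ε (S D).equivalence.inverse ≫ (S D).equivalence.inverse.map (ε F.functor)) ≫
            (S D).equivalence.inverse.map (F.functor.map
              ((S C).equivalence.counitIso.inv.app _)) =
          (ε (S D).equivalence.inverse ≫ (S D).equivalence.inverse.map
            (ε F.functor ≫ F.functor.map (ε (S C).equivalence.functor))) ≫
            (S D).equivalence.inverse.map (F.functor.map ((S C).equivalence.functor.map
              (ε (S C).equivalence.inverse)))
        simp only [Category.assoc, ← Functor.map_comp, ε_functor_comp_map_ε_inverse]
      tensor X Y := by
        change (μ (S D).equivalence.inverse _ _ ≫ (S D).equivalence.inverse.map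
              (μ F.functor _ _)) ≫
            (S D).equivalence.inverse.map (F.functor.map
              ((S C).equivalence.counitIso.inv.app _)) =
          ((S D).equivalence.inverse.map (F.functor.map
              ((S C).equivalence.counitIso.inv.app _)) ⊗ₘ
            (S D).equivalence.inverse.map (F.functor.map
              ((S C).equivalence.counitIso.inv.app _))) ≫
          (μ (S D).equivalence.inverse _ _ ≫ (S D).equivalence.inverse.map
            (μ F.functor _ _ ≫ F.functor.map (μ (S C).equivalence.functor _ _))) ≫
            (S D).equivalence.inverse.map (F.functor.map ((S C).equivalence.functor.map
              (μ (S C).equivalence.inverse _ _)))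
        simp only [Category.assoc, ← Functor.map_comp, μ_functor_comp_map_μ_inverse,
          μ_natural_assoc]
        simp only [Functor.map_comp, ← μ_natural_assoc]
        simp [← Functor.map_comp] }

section

variable {C D : SymMon.{v, u}}

/-- Stated for functors rather than for 1-cells of a bicategory, this serves the transformations
over `SymMon` and over `Perm` alike. -/
theorem conjHomIso_naturality {F F' : SymMonFunctor C.carrier D.carrier} (α : F ⟶ F') :
    whiskerRightHom (whiskerRightHom (whiskerLeftHom (S C).hom α) (S D).inv) (S D).hom ≫
        (conjHomIso F').hom =
      (conjHomIso F).hom ≫ whiskerLeftHom (S C).hom α :=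
  Hom.ext <| NatTrans.ext <| funext fun X =>
    (S D).equivalence.counit.naturality (α.nat.app ((S C).equivalence.functor.obj X))

theorem invConjIso_naturality {F F' : SymMonFunctor C.carrier D.carrier} (α : F ⟶ F') :
    whiskerRightHom α (S D).inv ≫ (invConjIso F').hom =
      (invConjIso F).hom ≫ whiskerLeftHom (S C).inv
        (whiskerRightHom (whiskerLeftHom (S C).hom α) (S D).inv) :=
  Hom.ext <| NatTrans.ext <| funext fun X => by
    change (S D).equivalence.inverse.map (α.nat.app X) ≫
        (S D).equivalence.inverse.map (F'.functor.map ((S C).equivalence.counitIso.inv.app X)) =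
      (S D).equivalence.inverse.map (F.functor.map ((S C).equivalence.counitIso.inv.app X)) ≫
        (S D).equivalence.inverse.map (α.nat.app _)
    simp [← Functor.map_comp]

end

end PermutativeModel

/-! ### Strong monoidal transformations between conjugation and the identity. -/

open scoped Pseudofunctor.StrongTrans

/-- An isomorphism between the underlying strong transformations is one between strong monoidal
transformations. -/
@[simps]
def SMCFunctor.Trans.isoMk {B : Type u₁} [Bicategory.{w₁, v₁} B] {C : Type u₂}
    [Bicategory.{w₂, v₂} C] [SMCCategory B] [SMCCategory C] {F G : SMCFunctor B C} {η θ : F ⟶ G}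
    (e : SMCFunctor.Trans.trans η ≅ SMCFunctor.Trans.trans θ) : η ≅ θ where
  hom := e.hom
  inv := e.inv
  hom_inv_id := e.hom_inv_id
  inv_hom_id := e.inv_hom_id

namespace PermutativeModel

open SymMonFunctor

variable (S : ∀ C : SymMon.{v, u}, PermutativeModel C)

/-- The equivalences form a strong monoidal transformation over `SymMon`. -/
def homTrans : (conjSMCFunctor S).comp Perm.inclusion ⟶ SMCFunctor.id SymMon.{v, u} where
  trans :=
    { app C := (S C).hom
      naturality F := conjHomIso F
      naturality_naturality α := conjHomIso_naturality S α
      naturality_id C := Hom.ext <| NatTrans.ext <| funext fun X => by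
        change (S C).equivalence.counitIso.hom.app ((S C).equivalence.functor.obj X) ≫ 𝟙 _ =
          (S C).equivalence.functor.map ((S C).equivalence.unitIso.inv.app X ≫ 𝟙 _) ≫ 𝟙 _ ≫ 𝟙 _
        simpa using (S C).equivalence.counit_app_functor X
      -- The inverse counit at `B` introduced by `conjComp` passes through the counit at `C` by
      -- naturality and cancels the counit contributed by `F`.
      naturality_comp {A B C} F G := Hom.ext <| NatTrans.ext <| funext fun X => by
        change (S C).equivalence.counitIso.hom.app _ ≫ 𝟙 _ =
          (S C).equivalence.functor.map ((S C).equivalence.inverse.map (G.functor.map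
              ((S B).equivalence.counitIso.inv.app _)) ≫ 𝟙 _) ≫ 𝟙 _ ≫
            (S C).equivalence.counitIso.hom.app _ ≫ 𝟙 _ ≫
              G.functor.map ((S B).equivalence.counitIso.hom.app _) ≫ 𝟙 _
        simp [← Functor.map_comp] }
  isMonoidal C D :=
    { unit := Hom.ext <| NatTrans.ext <| funext fun X => by
        change (ε (S D).equivalence.functor ≫ (S D).equivalence.functor.map
            (𝟙 _ ≫ (ε (S D).equivalence.inverse ≫ (S D).equivalence.inverse.map (𝟙 _)))) ≫
            (S D).equivalence.counitIso.hom.app _ = 𝟙 _ ≫ 𝟙 _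
        rw [Category.id_comp, ε_functor_comp_map_inverse]
        simp
      tensor F G := Hom.ext <| NatTrans.ext <| funext fun X => by
        change (μ (S D).equivalence.functor _ _ ≫ (S D).equivalence.functor.map
            (𝟙 _ ≫ (μ (S D).equivalence.inverse _ _ ≫ (S D).equivalence.inverse.map (𝟙 _)))) ≫
            (S D).equivalence.counitIso.hom.app _ =
          ((S D).equivalence.counitIso.hom.app _ ⊗ₘ (S D).equivalence.counitIso.hom.app _) ≫
            𝟙 _ ≫ 𝟙 _
        rw [Category.id_comp, μ_functor_comp_map_inverse]
        simp }

/-- The inverse equivalences form a strong monoidal transformation over `SymMon`. -/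
def invTrans : SMCFunctor.id SymMon.{v, u} ⟶ (conjSMCFunctor S).comp Perm.inclusion where
  trans :=
    { app C := (S C).inv
      naturality F := invConjIso F
      naturality_naturality α := invConjIso_naturality S α
      naturality_id C := Hom.ext <| NatTrans.ext <| funext fun X => by
        change (S C).equivalence.inverse.map ((S C).equivalence.counitIso.inv.app X) ≫
            (S C).equivalence.unitIso.inv.app _ ≫ 𝟙 _ =
          (S C).equivalence.inverse.map (𝟙 _) ≫ 𝟙 _ ≫ 𝟙 _
        -- Compatibility with identities is the triangle identity on the inverse side; the two
        -- remaining goals only remove identity morphisms.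
        refine Eq.trans ?_ (((S C).equivalence.inverse_counitInv_comp X).trans ?_)
        · simp [Equivalence.counitInv, Equivalence.unitInv]
        · exact ((congrArg _ (Category.comp_id _)).trans (Category.comp_id _) |>.trans
            ((S C).equivalence.inverse.map_id X)).symm
      -- This is naturality of the inverse counit at `B`, applied to the image under `F` of the
      -- inverse counit at `A`.
      naturality_comp {A B C} F G := Hom.ext <| NatTrans.ext <| funext fun X => by
        change (S C).equivalence.inverse.map (G.functor.map (F.functor.map
              ((S A).equivalence.counitIso.inv.app X))) ≫
            (S C).equivalence.inverse.map (G.functor.map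
              ((S B).equivalence.counitIso.inv.app _)) ≫ 𝟙 _ =
          (S C).equivalence.inverse.map (𝟙 _) ≫ 𝟙 _ ≫
            (S C).equivalence.inverse.map (G.functor.map
              ((S B).equivalence.counitIso.inv.app _)) ≫ 𝟙 _ ≫
            (S C).equivalence.inverse.map (G.functor.map ((S B).equivalence.functor.map
              ((S B).equivalence.inverse.map (F.functor.map
                ((S A).equivalence.counitIso.inv.app X))))) ≫ 𝟙 _
        simp [← Functor.map_comp] }
  isMonoidal C D :=
    { unit := Hom.ext <| NatTrans.ext <| funext fun X => by
        change (ε (S D).equivalence.inverse ≫ (S D).equivalence.inverse.map (𝟙 _)) ≫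
            (S D).equivalence.inverse.map (𝟙 _) =
          𝟙 _ ≫ 𝟙 _ ≫ (ε (S D).equivalence.inverse ≫ (S D).equivalence.inverse.map (𝟙 _))
        simp
      tensor F G := Hom.ext <| NatTrans.ext <| funext fun X => by
        change (μ (S D).equivalence.inverse _ _ ≫ (S D).equivalence.inverse.map (𝟙 _)) ≫
            (S D).equivalence.inverse.map
              (F.functor.map ((S C).equivalence.counitIso.inv.app X) ⊗ₘ
                G.functor.map ((S C).equivalence.counitIso.inv.app X)) =
          ((S D).equivalence.inverse.map
              (F.functor.map ((S C).equivalence.counitIso.inv.app X)) ⊗ₘ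
            (S D).equivalence.inverse.map
              (G.functor.map ((S C).equivalence.counitIso.inv.app X))) ≫
            𝟙 _ ≫ 𝟙 _ ≫ (μ (S D).equivalence.inverse _ _ ≫
              (S D).equivalence.inverse.map (𝟙 _))
        simp }

/-- The equivalences form a strong monoidal transformation over `Perm`. -/
def permHomTrans : Perm.inclusion.comp (conjSMCFunctor S) ⟶ SMCFunctor.id Perm.{v, u} where
  trans :=
    -- These functors need not be strict; they are 1-cells of `Perm` because `Perm` is full. The
    -- arguments over `SymMon` carry over, with the identities coming from the inclusion in other
    -- places.
    { app P := (S P.toSymMon).hom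
      naturality F := conjHomIso (S := S) F
      naturality_naturality α := conjHomIso_naturality S α
      naturality_id P := Hom.ext <| NatTrans.ext <| funext fun X => by
        change (S P.toSymMon).equivalence.counitIso.hom.app
            ((S P.toSymMon).equivalence.functor.obj X) ≫ 𝟙 _ =
          (S P.toSymMon).equivalence.functor.map ((S P.toSymMon).equivalence.inverse.map (𝟙 _) ≫
            (S P.toSymMon).equivalence.unitIso.inv.app X) ≫ 𝟙 _ ≫ 𝟙 _
        simpa using (S P.toSymMon).equivalence.counit_app_functor X
      naturality_comp {P Q R} F G := Hom.ext <| NatTrans.ext <| funext fun X => by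
        change (S R.toSymMon).equivalence.counitIso.hom.app _ ≫ 𝟙 _ =
          (S R.toSymMon).equivalence.functor.map ((S R.toSymMon).equivalence.inverse.map (𝟙 _) ≫
            (S R.toSymMon).equivalence.inverse.map ((SymMonFunctor.functor G).map
              ((S Q.toSymMon).equivalence.counitIso.inv.app _))) ≫ 𝟙 _ ≫
            (S R.toSymMon).equivalence.counitIso.hom.app _ ≫ 𝟙 _ ≫
              (SymMonFunctor.functor G).map
                ((S Q.toSymMon).equivalence.counitIso.hom.app _) ≫ 𝟙 _
        simp [← Functor.map_comp] }
  isMonoidal P Q :=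
    { unit := Hom.ext <| NatTrans.ext <| funext fun X => by
        change (ε (S Q.toSymMon).equivalence.functor ≫ (S Q.toSymMon).equivalence.functor.map
            ((ε (S Q.toSymMon).equivalence.inverse ≫
              (S Q.toSymMon).equivalence.inverse.map (𝟙 _)) ≫
                (S Q.toSymMon).equivalence.inverse.map (𝟙 _))) ≫
            (S Q.toSymMon).equivalence.counitIso.hom.app _ = 𝟙 _ ≫ 𝟙 _
        simp only [Category.assoc, ← Functor.map_comp]
        rw [← Category.assoc, ε_functor_comp_map_inverse]
        simp
      tensor F G := Hom.ext <| NatTrans.ext <| funext fun X => by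
        have h : ∀ U V : Q.toSymMon.carrier,
            (μ (S Q.toSymMon).equivalence.functor _ _ ≫ (S Q.toSymMon).equivalence.functor.map
              ((μ (S Q.toSymMon).equivalence.inverse U V ≫
                (S Q.toSymMon).equivalence.inverse.map (𝟙 _)) ≫
                  (S Q.toSymMon).equivalence.inverse.map (𝟙 _))) ≫
              (S Q.toSymMon).equivalence.counitIso.hom.app _ =
            ((S Q.toSymMon).equivalence.counitIso.hom.app U ⊗ₘ
              (S Q.toSymMon).equivalence.counitIso.hom.app V) ≫ 𝟙 _ ≫ 𝟙 _ := fun U V => by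
          simp only [Category.assoc, ← Functor.map_comp]
          rw [← Category.assoc, μ_functor_comp_map_inverse]
          simp
        exact h ((SymMonFunctor.functor F).obj ((S P.toSymMon).equivalence.functor.obj X))
          ((SymMonFunctor.functor G).obj ((S P.toSymMon).equivalence.functor.obj X)) }

/-- The inverse equivalences form a strong monoidal transformation over `Perm`. -/
def permInvTrans : SMCFunctor.id Perm.{v, u} ⟶ Perm.inclusion.comp (conjSMCFunctor S) where
  trans :=
    { app P := (S P.toSymMon).inv
      naturality F := invConjIso (S := S) F
      naturality_naturality α := invConjIso_naturality S α
      naturality_id P := Hom.ext <| NatTrans.ext <| funext fun X => by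
        change (S P.toSymMon).equivalence.inverse.map
              ((S P.toSymMon).equivalence.counitIso.inv.app X) ≫
            (S P.toSymMon).equivalence.inverse.map (𝟙 _) ≫
              (S P.toSymMon).equivalence.unitIso.inv.app _ =
          (S P.toSymMon).equivalence.inverse.map (𝟙 _) ≫ 𝟙 _ ≫ 𝟙 _
        refine Eq.trans ?_ (((S P.toSymMon).equivalence.inverse_counitInv_comp X).trans ?_)
        · simp [Equivalence.counitInv, Equivalence.unitInv]
        · exact ((congrArg _ (Category.comp_id _)).trans (Category.comp_id _) |>.trans
            ((S P.toSymMon).equivalence.inverse.map_id X)).symm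
      naturality_comp {P Q R} F G := Hom.ext <| NatTrans.ext <| funext fun X => by
        change (S R.toSymMon).equivalence.inverse.map ((SymMonFunctor.functor G).map
              ((SymMonFunctor.functor F).map
                ((S P.toSymMon).equivalence.counitIso.inv.app X))) ≫
            (S R.toSymMon).equivalence.inverse.map (𝟙 _) ≫
            (S R.toSymMon).equivalence.inverse.map ((SymMonFunctor.functor G).map
              ((S Q.toSymMon).equivalence.counitIso.inv.app _)) =
          (S R.toSymMon).equivalence.inverse.map (𝟙 _) ≫ 𝟙 _ ≫
            (S R.toSymMon).equivalence.inverse.map ((SymMonFunctor.functor G).map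
              ((S Q.toSymMon).equivalence.counitIso.inv.app _)) ≫ 𝟙 _ ≫
            (S R.toSymMon).equivalence.inverse.map ((SymMonFunctor.functor G).map
              ((S Q.toSymMon).equivalence.functor.map ((S Q.toSymMon).equivalence.inverse.map
                ((SymMonFunctor.functor F).map
                  ((S P.toSymMon).equivalence.counitIso.inv.app X))))) ≫ 𝟙 _
        simp [← Functor.map_comp] }
  isMonoidal P Q :=
    { unit := Hom.ext <| NatTrans.ext <| funext fun X => by
        change (ε (S Q.toSymMon).equivalence.inverse ≫
              (S Q.toSymMon).equivalence.inverse.map (𝟙 _)) ≫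
            (S Q.toSymMon).equivalence.inverse.map (𝟙 _) =
          𝟙 _ ≫ (ε (S Q.toSymMon).equivalence.inverse ≫
            (S Q.toSymMon).equivalence.inverse.map (𝟙 _)) ≫
              (S Q.toSymMon).equivalence.inverse.map (𝟙 _)
        simp
      tensor F G := Hom.ext <| NatTrans.ext <| funext fun X => by
        change (μ (S Q.toSymMon).equivalence.inverse _ _ ≫
              (S Q.toSymMon).equivalence.inverse.map (𝟙 _)) ≫
            (S Q.toSymMon).equivalence.inverse.map
              ((SymMonFunctor.functor F).map
                  ((S P.toSymMon).equivalence.counitIso.inv.app X) ⊗ₘ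
                (SymMonFunctor.functor G).map
                  ((S P.toSymMon).equivalence.counitIso.inv.app X)) =
          ((S Q.toSymMon).equivalence.inverse.map
              ((SymMonFunctor.functor F).map
                ((S P.toSymMon).equivalence.counitIso.inv.app X)) ⊗ₘ
            (S Q.toSymMon).equivalence.inverse.map
              ((SymMonFunctor.functor G).map
                ((S P.toSymMon).equivalence.counitIso.inv.app X))) ≫
            𝟙 _ ≫ (μ (S Q.toSymMon).equivalence.inverse _ _ ≫
              (S Q.toSymMon).equivalence.inverse.map (𝟙 _)) ≫
                (S Q.toSymMon).equivalence.inverse.map (𝟙 _)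
        simp }

/-! ### Invertible modifications given by units and counits. -/

section

variable {C D : SymMon.{v, u}} (F : SymMonFunctor C.carrier D.carrier)

/-- The modification axiom for the units, at an object. One triangle identity at `C` turns the
inverse counit into the image of the unit; another at `D` cancels the remaining pair. The identity
factors are those in the bicategorical composites, so the statement applies over both `SymMon` and
`Perm`. -/
theorem unit_conj (X : (S C).perm.toSymMon.carrier) :
    (S D).equivalence.unitIso.hom.app ((conj S F).functor.obj X) ≫ 𝟙 _ ≫
        (S D).equivalence.inverse.map ((S D).equivalence.counitIso.hom.app _) ≫ 𝟙 _ ≫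
          (S D).equivalence.inverse.map (F.functor.map
            ((S C).equivalence.counitIso.inv.app ((S C).equivalence.functor.obj X))) ≫ 𝟙 _ =
      (𝟙 _ ≫ 𝟙 _) ≫ (S D).equivalence.inverse.map (F.functor.map
        ((S C).equivalence.functor.map ((S C).equivalence.unitIso.hom.app X))) := by
  have h := (S C).equivalence.counitInv_app_functor X
  dsimp only [Equivalence.counitInv, Equivalence.unit] at h
  rw [h]
  simp [conj, inv, hom, compFunctor]

/-- Naturality of the counit at `D` moves the inverse counit at `C` out of the round trip, where it
cancels the counit at `C`. -/
theorem counit_conj (X : C.carrier) :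
    (S D).equivalence.counitIso.hom.app (F.functor.obj X) ≫ 𝟙 _ ≫ 𝟙 _ =
      (𝟙 _ ≫ (S D).equivalence.functor.map ((S D).equivalence.inverse.map (F.functor.map
          ((S C).equivalence.counitIso.inv.app X))) ≫ 𝟙 _ ≫
            (S D).equivalence.counitIso.hom.app _ ≫ 𝟙 _) ≫
        F.functor.map ((S C).equivalence.counitIso.hom.app X) := by
  simp [← Functor.map_comp]

end

/-- The units of the equivalences form an invertible modification over `SymMon`. -/
def unitModification : 𝟙 ((conjSMCFunctor S).comp Perm.inclusion) ≅ homTrans S ≫ invTrans S :=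
  SMCFunctor.Trans.isoMk <| Pseudofunctor.StrongTrans.isoMk (fun C => (S C).unit)
    (fun F => Hom.ext <| NatTrans.ext <| funext fun X => unit_conj S F X)

/-- The counits of the equivalences form an invertible modification over `SymMon`. -/
def counitModification : invTrans S ≫ homTrans S ≅ 𝟙 (SMCFunctor.id SymMon.{v, u}) :=
  SMCFunctor.Trans.isoMk <| Pseudofunctor.StrongTrans.isoMk (fun C => (S C).counit)
    (fun F => Hom.ext <| NatTrans.ext <| funext fun X => counit_conj S F X)

/-- The units of the equivalences form an invertible modification over `Perm`. -/
def permUnitModification :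
    𝟙 (Perm.inclusion.comp (conjSMCFunctor S)) ≅ permHomTrans S ≫ permInvTrans S :=
  SMCFunctor.Trans.isoMk <| Pseudofunctor.StrongTrans.isoMk (fun P => (S P.toSymMon).unit)
    (fun F => Hom.ext <| NatTrans.ext <| funext fun X => unit_conj S F X)

/-- The counits of the equivalences form an invertible modification over `Perm`. -/
def permCounitModification : permInvTrans S ≫ permHomTrans S ≅ 𝟙 (SMCFunctor.id Perm.{v, u}) :=
  SMCFunctor.Trans.isoMk <| Pseudofunctor.StrongTrans.isoMk (fun P => (S P.toSymMon).counit)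
    (fun F => Hom.ext <| NatTrans.ext <| funext fun X => counit_conj S F X)

end PermutativeModel

end SMC

theorem proposition6p1 :
    (SMC.Perm.inclusion : SMC.SMCFunctor SMC.Perm.{v, u} SMC.SymMon.{v, u}).IsBiequivalence := by
  let S := SMC.strictificationModel.{v, u}
  exact ⟨SMC.PermutativeModel.conjSMCFunctor S,
    -- Adjointification replaces the counit by one satisfying the triangle identity, so none has to
    -- be verified for the modifications.
    ⟨.mkOfAdjointifyCounit (SMC.PermutativeModel.unitModification S)
      (SMC.PermutativeModel.counitModification S)⟩,
    -- This equivalence starts at the identity, so its forward 1-cell is `permInvTrans`; unit and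
    -- counit therefore exchange roles and are inverted.
    ⟨.mkOfAdjointifyCounit (SMC.PermutativeModel.permCounitModification S).symm
      (SMC.PermutativeModel.permUnitModification S).symm⟩⟩
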